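/- Let $\mathcal X,\mathcal Y,\mathcal Z$ be finite alphabets and let $p(y,z|x)$ be a two-receiver discrete memoryless broadcast channel. For finite alphabets $\mathcal U,\mathcal V$ and a joint distribution $p(u,v,x)=p(u,v)p(x|u,v)$, let $(U,V,X,Y,Z)\sim p(u,v)p(x|u,v)p(y,z|x)$; all information quantities are in bits. Let - $\mathcal C$ be the set of pairs $(R_1,R_2)$ such that, for some finite $\mathcal U,\mathcal V$ and some $p(u,v)p(x|u,v)$, $$R_1\le I(U;Y),\quad R_2\le I(V;Z),\quad R_1+R_2\le I(U;Y)+I(V;Z|U),\quad R_1+R_2\le I(V;Z)+I(U;Y|V);$$ - $\mathcal C'$ be the set of pairs $(R_1,R_2)$ such that, for some finite $\mathcal U,\mathcal V$ and some $p(u,v)p(x|u,v)$, $$R_1\le I(U;Y),\quad R_2\le I(V;Z),\quad R_1+R_2\le I(U;Y)+I(X;Z|U),\quad R_1+R_2\le I(V;Z)+I(X;Y|V);$$ - $\mathcal C'_d$ be defined as $\mathcal C'$, but with $X$ restricted to be a deterministic function of $(U,V)$, i.e. $p(x|u,v)\in\{0,1\}$ for all $u,v,x$. A pair $(R_1,R_2)$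 with $R_1,R_2\ge 0$ is achievable with no common information if there are codes of block lengths $n=0,1,2,\dots$, with two independent private messages uniform on $\{1,\dots,\lfloor 2^{nR_1}\rfloor\}$ and $\{1,\dots,\lfloor 2^{nR_2}\rfloor\}$, a deterministic encoder, and one decoder per receiver (the first observing $Y^n$ and estimating the first message, the second observing $Z^n$ and estimating the second), such that the probability that at least one receiver errs tends to $0$ as $n\to\infty$. The capacity region with no common information is the closure of the set of achievable pairs. Then $\mathcal C'_d$ is an outer bound: the capacity region with no common information is contained in $\mathcal C'_d$. Moreover, $\mathcal C=\mathcal C'_d$ (the outer bound $\mathcal C$ can be rewritten as $\mathcal C'_d$), and $\mathcal C'=\mathcal C'_d$ (the determinism constraint can be dropped). -/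

import Mathlib

namespace BCOuter

open Filter Topology

noncomputable section

/-! ### Information measures (in bits) on a finite probability space -/

open Classical in
/-- The probability mass function of the random variable `f` when the sample point has
probability mass function `P`. -/
def law {Ω α : Type*} [Fintype Ω] (P : Ω → ℝ) (f : Ω → α) (a : α) : ℝ :=
  ∑ ω, if f ω = a then P ω else 0

/-- `I(A;B) = ∑ p(a,b) log₂ (p(a,b) / (p(a) p(b)))`. Terms with `p(a,b) = 0` vanish. -/
def mutualInfo {Ω α β : Type*} [Fintype Ω] [Fintype α] [Fintype β]
    (P : Ω → ℝ) (A : Ω → α) (B : Ω → β) : ℝ :=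
  ∑ a, ∑ b, law P (fun ω => (A ω, B ω)) (a, b) *
    Real.logb 2 (law P (fun ω => (A ω, B ω)) (a, b) / (law P A a * law P B b))

/-- `I(A;B|C) = ∑ p(a,b,c) log₂ (p(a,b,c) p(c) / (p(a,c) p(b,c)))`.
Terms with `p(a,b,c) = 0` vanish. -/
def condMutualInfo {Ω α β γ : Type*} [Fintype Ω] [Fintype α] [Fintype β] [Fintype γ]
    (P : Ω → ℝ) (A : Ω → α) (B : Ω → β) (C : Ω → γ) : ℝ :=
  ∑ a, ∑ b, ∑ c, law P (fun ω => (A ω, B ω, C ω)) (a, b, c) *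
    Real.logb 2 (law P (fun ω => (A ω, B ω, C ω)) (a, b, c) * law P C c /
      (law P (fun ω => (A ω, C ω)) (a, c) * law P (fun ω => (B ω, C ω)) (b, c)))

/-! ### Broadcast channels, codes and the capacity region -/

/-- A two-receiver discrete memoryless broadcast channel: `prob x (y, z) = p(y,z|x)`. -/
structure Channel (X Y Z : Type*) [Fintype Y] [Fintype Z] where
  prob : X → Y × Z → ℝ
  prob_mem : ∀ x, prob x ∈ stdSimplex ℝ (Y × Z)

/-- A block code of length `n` with common message set `M₀` and private message sets
`M₁`, `M₂`. -/
structure Code (X Y Z M₀ M₁ M₂ : Type*) (n : ℕ) where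
  enc : M₀ → M₁ → M₂ → (Fin n → X)
  decY : (Fin n → Y) → M₀ × M₁
  decZ : (Fin n → Z) → M₀ × M₂

open Classical in
/-- The probability that some receiver gets one of its messages wrong, when the messages are
uniformly distributed and the channel is used `n` times without memory. -/
def Code.errorProb {X Y Z M₀ M₁ M₂ : Type*} [Fintype Y] [Fintype Z]
    [Fintype M₀] [Fintype M₁] [Fintype M₂] {n : ℕ}
    (c : Code X Y Z M₀ M₁ M₂ n) (p : Channel X Y Z) : ℝ :=
  (∑ m₀, ∑ m₁, ∑ m₂, ∑ y : Fin n → Y, ∑ z : Fin n → Z,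
      if c.decY y ≠ (m₀, m₁) ∨ c.decZ z ≠ (m₀, m₂) then
        ∏ i, p.prob (c.enc m₀ m₁ m₂ i) (y i, z i) else 0) /
    (Fintype.card M₀ * Fintype.card M₁ * Fintype.card M₂)

/-- The index set `[1, 2^{nR}]` of messages: it has `⌊2^{nR}⌋` elements. -/
abbrev Message (n : ℕ) (R : ℝ) : Type := Fin ⌊(2 : ℝ) ^ ((n : ℝ) * R)⌋₊

/-- The (nonnegative) rate triple `(R₀, R₁, R₂)` is achievable. -/
def Achievable {X Y Z : Type*} [Fintype Y] [Fintype Z] (p : Channel X Y Z)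
    (R₀ R₁ R₂ : ℝ) : Prop :=
  0 ≤ R₀ ∧ 0 ≤ R₁ ∧ 0 ≤ R₂ ∧
    ∃ c : ∀ n : ℕ, Code X Y Z (Message n R₀) (Message n R₁) (Message n R₂) n,
      Tendsto (fun n => (c n).errorProb p) atTop (𝓝 0)

/-- The capacity region with no common information: the closure of the set of achievable
pairs `(R₁, R₂)` at common rate `R₀ = 0`. -/
def capacityRegionNoCommon {X Y Z : Type*} [Fintype Y] [Fintype Z] (p : Channel X Y Z) :
    Set (ℝ × ℝ) :=
  closure {R | Achievable p 0 R.1 R.2}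

/-! ### The outer bounds -/

/-- A joint distribution `p(u,v,x) = p(u,v) p(x|u,v)`. -/
structure AuxInput (U V X : Type*) [Fintype U] [Fintype V] [Fintype X] where
  pUV : U × V → ℝ
  pUV_mem : pUV ∈ stdSimplex ℝ (U × V)
  pX : U → V → X → ℝ
  pX_mem : ∀ u v, pX u v ∈ stdSimplex ℝ X

section

variable {U V X Y Z : Type*} [Fintype U] [Fintype V] [Fintype X] [Fintype Y] [Fintype Z]

/-- `X` is a deterministic function of `(U, V)`: `p(x|u,v) ∈ {0,1}`. -/
def AuxInput.IsDeterministic (q : AuxInput U V X) : Prop :=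
  ∀ u v x, q.pX u v x = 0 ∨ q.pX u v x = 1

/-- The joint distribution `p(u,v) p(x|u,v) p(y,z|x)` of `(U, V, X, Y, Z)`. -/
def AuxInput.joint (q : AuxInput U V X) (p : Channel X Y Z) : U × V × X × Y × Z → ℝ :=
  fun (u, v, x, y, z) => q.pUV (u, v) * q.pX u v x * p.prob x (y, z)

/-- The coordinate random variables on the space of the joint distribution. -/
def rvU : U × V × X × Y × Z → U := fun ω => ω.1

/-- The coordinate `V` of the joint space. -/
def rvV : U × V × X × Y × Z → V := fun ω => ω.2.1

/-- The coordinate `X` of the joint space. -/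
def rvX : U × V × X × Y × Z → X := fun ω => ω.2.2.1

/-- The coordinate `Y` of the joint space. -/
def rvY : U × V × X × Y × Z → Y := fun ω => ω.2.2.2.1

/-- The coordinate `Z` of the joint space. -/
def rvZ : U × V × X × Y × Z → Z := fun ω => ω.2.2.2.2

/-- The rate pairs with `R₁ ≤ I(U;Y)`, `R₂ ≤ I(V;Z)`, `R₁+R₂ ≤ I(U;Y)+I(V;Z|U)` and
`R₁+R₂ ≤ I(V;Z)+I(U;Y|V)`. -/
def AuxInput.regionUV (q : AuxInput U V X) (p : Channel X Y Z) : Set (ℝ × ℝ) :=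
  {R | R.1 ≤ mutualInfo (q.joint p) rvU rvY ∧
    R.2 ≤ mutualInfo (q.joint p) rvV rvZ ∧
    R.1 + R.2 ≤ mutualInfo (q.joint p) rvU rvY + condMutualInfo (q.joint p) rvV rvZ rvU ∧
    R.1 + R.2 ≤ mutualInfo (q.joint p) rvV rvZ + condMutualInfo (q.joint p) rvU rvY rvV}

/-- The rate pairs with `R₁ ≤ I(U;Y)`, `R₂ ≤ I(V;Z)`, `R₁+R₂ ≤ I(U;Y)+I(X;Z|U)` and
`R₁+R₂ ≤ I(V;Z)+I(X;Y|V)`. -/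
def AuxInput.regionX (q : AuxInput U V X) (p : Channel X Y Z) : Set (ℝ × ℝ) :=
  {R | R.1 ≤ mutualInfo (q.joint p) rvU rvY ∧
    R.2 ≤ mutualInfo (q.joint p) rvV rvZ ∧
    R.1 + R.2 ≤ mutualInfo (q.joint p) rvU rvY + condMutualInfo (q.joint p) rvX rvZ rvU ∧
    R.1 + R.2 ≤ mutualInfo (q.joint p) rvV rvZ + condMutualInfo (q.joint p) rvX rvY rvV}

/-- The outer bound with no common information: the union of the regions `regionUV` over all
finite alphabets of `U`, `V` and all `p(u,v) p(x|u,v)`. -/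
def outerBound (p : Channel X Y Z) : Set (ℝ × ℝ) :=
  {R | ∃ (U V : Type) (_ : Fintype U) (_ : Fintype V) (q : AuxInput U V X),
    R ∈ q.regionUV p}

/-- The rewritten bound: the union of the regions `regionX` over all `p(u,v) p(x|u,v)`
with `X` a deterministic function of `(U, V)`. -/
def outerBoundXDet (p : Channel X Y Z) : Set (ℝ × ℝ) :=
  {R | ∃ (U V : Type) (_ : Fintype U) (_ : Fintype V) (q : AuxInput U V X),
    q.IsDeterministic ∧ R ∈ q.regionX p}

/-- The rewritten bound without the determinism constraint. -/
def outerBoundX (p : Channel X Y Z) : Set (ℝ × ℝ) :=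
  {R | ∃ (U V : Type) (_ : Fintype U) (_ : Fintype V) (q : AuxInput U V X),
    R ∈ q.regionX p}

end

end

end BCOuter

/-! Everything passes through one set, `hullRegion`. The four bounds of `regionX` involve only the
law `q` of `X`, the pair `H(Y|U), H(Z|U)`, and the pair `H(Z|V), H(Y|V)`; the joint law of `U` and
`V` never enters. The triples `(q, H(Y|U), H(Z|U))` are points of the convex hull of the graph of `q
↦ (H(Y), H(Z))`, so `outerBoundX ⊆ hullRegion`.

Conversely (`hullRegion_subset_outerBoundXDet`), two hull points over the same `q` give auxiliaries
`I` and `J`, which may be coupled at will. Split `X` by a one-time pad into shares `A + B = X`, each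
alone independent of `(I, J, X)`, and put `U = (I, A)`, `V = (J, B)`. No entropy in the bounds
changes, yet `X` has become a function of `(U, V)`. Data processing gives `outerBound ⊆
outerBoundX`, and it is an equality when `X` is a function of `(U, V)`, so `outerBoundXDet ⊆
outerBound`; the three bounds coincide.

For the converse, `hullRegion` is closed (Carathéodory and compactness), so it suffices to treat one
code at slightly reduced rates (`Code.mem_hullRegion`). Fano's inequality and the Csiszár sum
identity for the auxiliaries (message, past of one output, future of the other) give the block
bounds; convexity of the hull averages over time, with no time-sharing variable. All entropy
inequalities used come from Gibbs' inequality `ent_le_of_sum_le`. -/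

namespace BCOuter

open Filter Topology

noncomputable section

/-! ### Entropy of random variables on a finite space -/

section Entropy

variable {Ω α β γ : Type*} [Fintype Ω] {P : Ω → ℝ}

/-- The entropy, in nats, of the random variable `f`. -/
def ent (P : Ω → ℝ) (f : Ω → α) : ℝ := -∑ ω, P ω * Real.log (law P f (f ω))

theorem law_nonneg (hP : ∀ ω, 0 ≤ P ω) (f : Ω → α) (a : α) : 0 ≤ law P f a :=
  Finset.sum_nonneg fun ω _ => by split_ifs <;> simp [hP]

theorem le_law (hP : ∀ ω, 0 ≤ P ω) (f : Ω → α) (ω : Ω) : P ω ≤ law P f (f ω) := by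
  classical
  have h := Finset.single_le_sum (f := fun ω' => if f ω' = f ω then P ω' else 0)
    (fun ω' _ => by split_ifs <;> simp [hP]) (Finset.mem_univ ω)
  simp only [if_true] at h
  refine h.trans (le_of_eq ?_)
  unfold law
  exact Finset.sum_congr rfl fun ω' _ => by congr

theorem law_pos (hP : ∀ ω, 0 ≤ P ω) (f : Ω → α) {ω : Ω} (h : P ω ≠ 0) :
    0 < law P f (f ω) :=
  lt_of_lt_of_le (lt_of_le_of_ne (hP ω) h.symm) (le_law hP f ω)

/-- Entropies are handled as expectations over `Ω`, where points of mass zero simply drop out; this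
is the passage to and from sums over values. -/
theorem sum_law_mul [Fintype α] (P : Ω → ℝ) (f : Ω → α) (F : α → ℝ) :
    ∑ a, law P f a * F a = ∑ ω, P ω * F (f ω) := by
  classical
  simp only [law, Finset.sum_mul]
  rw [Finset.sum_comm]
  refine Finset.sum_congr rfl fun ω _ => ?_
  simp [ite_mul]

theorem sum_law [Fintype α] (P : Ω → ℝ) (f : Ω → α) : ∑ a, law P f a = ∑ ω, P ω := by
  simpa using sum_law_mul P f fun _ => 1

theorem law_eq_zero_of_comp (hP : ∀ ω, 0 ≤ P ω) (f : Ω → α) (h : α → β) {a : α}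
    (h0 : law P (fun ω => h (f ω)) (h a) = 0) : law P f a = 0 := by
  classical
  refine le_antisymm (h0 ▸ ?_) (law_nonneg hP _ _)
  refine Finset.sum_le_sum fun ω _ => ?_
  by_cases hω : f ω = a
  · simp [hω]
  · simp only [hω, if_false]
    split_ifs <;> simp [hP]

theorem sum_law_prod_right [Fintype β] (P : Ω → ℝ) (f : Ω → α) (g : Ω → β) (a : α) :
    ∑ b, law P (fun ω => (f ω, g ω)) (a, b) = law P f a := by
  classical
  simp only [law]
  rw [Finset.sum_comm]
  refine Finset.sum_congr rfl fun ω _ => ?_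
  by_cases h : f ω = a <;> simp [Prod.ext_iff, h]

theorem sum_law_prod_left [Fintype α] (P : Ω → ℝ) (f : Ω → α) (g : Ω → β) (b : β) :
    ∑ a, law P (fun ω => (f ω, g ω)) (a, b) = law P g b := by
  classical
  simp only [law]
  rw [Finset.sum_comm]
  refine Finset.sum_congr rfl fun ω _ => ?_
  by_cases h : g ω = b <;> simp [Prod.ext_iff, h]

theorem law_congr (P : Ω → ℝ) {f : Ω → α} {g : Ω → β} {a : α} {b : β}
    (h : ∀ ω, P ω ≠ 0 → (f ω = a ↔ g ω = b)) : law P f a = law P g b := by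
  classical
  refine Finset.sum_congr rfl fun ω _ => ?_
  by_cases h0 : P ω = 0
  · simp [h0]
  · simp [h ω h0]

/-- Random variables that determine each other almost surely have the same entropy. -/
theorem ent_congr {f : Ω → α} {g : Ω → β}
    (h : ∀ ω ω', P ω ≠ 0 → P ω' ≠ 0 → (f ω' = f ω ↔ g ω' = g ω)) : ent P f = ent P g := by
  unfold ent
  congr 1
  refine Finset.sum_congr rfl fun ω _ => ?_
  by_cases h0 : P ω = 0
  · simp [h0]
  · rw [law_congr P fun ω' h' => h ω ω' h0 h']

theorem ent_eq_sum_negMulLog [Fintype α] (P : Ω → ℝ) (f : Ω → α) :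
    ent P f = ∑ a, Real.negMulLog (law P f a) := by
  simp only [Real.negMulLog, neg_mul, Finset.sum_neg_distrib]
  rw [sum_law_mul P f fun a => Real.log (law P f a)]
  rfl

/-- Turns bits into nats; from here on information bounds are linear inequalities between values of
`ent`. -/
theorem mutualInfo_mul_log [Fintype α] [Fintype β] (hP : ∀ ω, 0 ≤ P ω) (A : Ω → α) (B : Ω → β) :
    mutualInfo P A B * Real.log 2 = ent P A + ent P B - ent P (fun ω => (A ω, B ω)) := by
  have h2 : Real.log 2 ≠ 0 := (Real.log_pos one_lt_two).ne'
  unfold mutualInfo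
  rw [← Fintype.sum_prod_type' (f := fun a b => law P (fun ω => (A ω, B ω)) (a, b) *
    Real.logb 2 (law P (fun ω => (A ω, B ω)) (a, b) / (law P A a * law P B b)))]
  rw [sum_law_mul P (fun ω => (A ω, B ω)) fun x =>
    Real.logb 2 (law P (fun ω => (A ω, B ω)) x / (law P A x.1 * law P B x.2))]
  simp only [ent, Finset.sum_mul, ← Finset.sum_neg_distrib, ← Finset.sum_add_distrib,
    ← Finset.sum_sub_distrib]
  refine Finset.sum_congr rfl fun ω _ => ?_
  by_cases h0 : P ω = 0
  · simp [h0]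
  have hA := (law_pos hP A h0).ne'
  have hB := (law_pos hP B h0).ne'
  have hAB := (law_pos hP (fun ω => (A ω, B ω)) h0).ne'
  rw [Real.logb, mul_assoc, div_mul_cancel₀ _ h2, Real.log_div hAB (mul_ne_zero hA hB),
    Real.log_mul hA hB]
  ring

theorem condMutualInfo_mul_log [Fintype α] [Fintype β] [Fintype γ] (hP : ∀ ω, 0 ≤ P ω)
    (A : Ω → α) (B : Ω → β) (C : Ω → γ) :
    condMutualInfo P A B C * Real.log 2 = ent P (fun ω => (A ω, C ω)) + ent P (fun ω => (B ω, C ω))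
      - ent P (fun ω => (A ω, B ω, C ω)) - ent P C := by
  have h2 : Real.log 2 ≠ 0 := (Real.log_pos one_lt_two).ne'
  have h := sum_law_mul P (fun ω => (A ω, B ω, C ω)) fun x =>
    Real.logb 2 (law P (fun ω => (A ω, B ω, C ω)) x * law P C x.2.2 /
      (law P (fun ω => (A ω, C ω)) (x.1, x.2.2) * law P (fun ω => (B ω, C ω)) (x.2.1, x.2.2)))
  simp only [Fintype.sum_prod_type] at h
  unfold condMutualInfo
  rw [h]
  simp only [ent, Finset.sum_mul, ← Finset.sum_neg_distrib, ← Finset.sum_add_distrib,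
    ← Finset.sum_sub_distrib]
  refine Finset.sum_congr rfl fun ω _ => ?_
  by_cases h0 : P ω = 0
  · simp [h0]
  have hC := (law_pos hP C h0).ne'
  have hAC := (law_pos hP (fun ω => (A ω, C ω)) h0).ne'
  have hBC := (law_pos hP (fun ω => (B ω, C ω)) h0).ne'
  have hABC := (law_pos hP (fun ω => (A ω, B ω, C ω)) h0).ne'
  rw [Real.logb, mul_assoc, div_mul_cancel₀ _ h2, Real.log_div (mul_ne_zero hABC hC)
    (mul_ne_zero hAC hBC), Real.log_mul hAC hBC, Real.log_mul hABC hC]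
  ring

/-- Gibbs' inequality: coding `f` with a subprobability `Q` costs at least the entropy. -/
theorem ent_le_of_sum_le [Fintype α] (hP : ∀ ω, 0 ≤ P ω) (f : Ω → α) (Q : α → ℝ)
    (hQ : ∀ a, 0 ≤ Q a) (hpos : ∀ ω, P ω ≠ 0 → 0 < Q (f ω)) (hsum : ∑ a, Q a ≤ ∑ ω, P ω) :
    ent P f ≤ -∑ ω, P ω * Real.log (Q (f ω)) := by
  have h1 : ∑ ω, P ω * (Real.log (Q (f ω)) - Real.log (law P f (f ω))) ≤
      ∑ ω, P ω * (Q (f ω) / law P f (f ω) - 1) := by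
    refine Finset.sum_le_sum fun ω _ => ?_
    by_cases h0 : P ω = 0
    · simp [h0]
    refine mul_le_mul_of_nonneg_left ?_ (hP ω)
    have hl := law_pos hP f h0
    rw [← Real.log_div (hpos ω h0).ne' hl.ne']
    exact Real.log_le_sub_one_of_pos (div_pos (hpos ω h0) hl)
  have h2 : ∑ ω, P ω * (Q (f ω) / law P f (f ω) - 1) ≤ 0 := by
    rw [← sum_law_mul P f fun a => Q a / law P f a - 1]
    have : ∑ a, law P f a * (Q a / law P f a - 1) ≤ ∑ a, (Q a - law P f a) := by
      refine Finset.sum_le_sum fun a _ => ?_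
      by_cases h0 : law P f a = 0
      · simp [h0, hQ]
      · field_simp; rfl
    refine this.trans ?_
    rw [Finset.sum_sub_distrib, sum_law]
    linarith
  have h3 := h1.trans h2
  simp only [mul_sub, Finset.sum_sub_distrib] at h3
  unfold ent
  linarith

/-- Submodularity of entropy: `H(A,B,C) + H(C) ≤ H(A,C) + H(B,C)`. -/
theorem ent_submodular [Fintype α] [Fintype β] [Fintype γ] (hP : ∀ ω, 0 ≤ P ω)
    (A : Ω → α) (B : Ω → β) (C : Ω → γ) :
    ent P (fun ω => (A ω, B ω, C ω)) + ent P C ≤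
      ent P (fun ω => (A ω, C ω)) + ent P (fun ω => (B ω, C ω)) := by
  -- The comparison law `p(a,c) p(b,c) / p(c)` makes `A` and `B` conditionally independent given
  -- `C`.
  have h := ent_le_of_sum_le hP (fun ω => (A ω, B ω, C ω)) (fun x =>
    law P (fun ω => (A ω, C ω)) (x.1, x.2.2) * law P (fun ω => (B ω, C ω)) (x.2.1, x.2.2) /
      law P C x.2.2)
    (fun x => div_nonneg (mul_nonneg (law_nonneg hP _ _) (law_nonneg hP _ _)) (law_nonneg hP _ _))
    (fun ω h0 => div_pos (mul_pos (law_pos hP (fun ω => (A ω, C ω)) h0)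
      (law_pos hP (fun ω => (B ω, C ω)) h0)) (law_pos hP C h0)) ?_
  · have e : ∑ ω, P ω * Real.log (law P (fun ω => (A ω, C ω)) (A ω, C ω) *
        law P (fun ω => (B ω, C ω)) (B ω, C ω) / law P C (C ω)) =
        -ent P (fun ω => (A ω, C ω)) - ent P (fun ω => (B ω, C ω)) + ent P C := by
      simp only [ent, neg_neg, sub_neg_eq_add, ← sub_eq_add_neg, ← Finset.sum_add_distrib,
        ← Finset.sum_sub_distrib]
      refine Finset.sum_congr rfl fun ω _ => ?_
      by_cases h0 : P ω = 0
      · simp [h0]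
      have hC := (law_pos hP C h0).ne'
      have hAC := (law_pos hP (fun ω => (A ω, C ω)) h0).ne'
      have hBC := (law_pos hP (fun ω => (B ω, C ω)) h0).ne'
      rw [Real.log_div (mul_ne_zero hAC hBC) hC, Real.log_mul hAC hBC]
      ring
    simp only [e] at h
    linarith
  · simp only [Fintype.sum_prod_type]
    have : ∀ a, ∑ b, ∑ c, law P (fun ω => (A ω, C ω)) (a, c) *
        law P (fun ω => (B ω, C ω)) (b, c) / law P C c =
        ∑ c, law P (fun ω => (A ω, C ω)) (a, c) * (law P C c / law P C c) := fun a => by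
      rw [Finset.sum_comm]
      refine Finset.sum_congr rfl fun c _ => ?_
      rw [← Finset.sum_div, ← Finset.mul_sum, sum_law_prod_left P B C c, mul_div_assoc]
    simp only [this]
    rw [← sum_law P (fun ω => (A ω, C ω)), Fintype.sum_prod_type]
    refine Finset.sum_le_sum fun a _ => Finset.sum_le_sum fun c _ => ?_
    exact mul_le_of_le_one_right (law_nonneg hP _ _) (div_self_le_one _)

/-- Conditioning on more reduces entropy. -/
theorem ent_sub_le_of_comp [Fintype α] [Fintype β] [Fintype γ] (hP : ∀ ω, 0 ≤ P ω)
    (A : Ω → α) (B : Ω → β) (h : β → γ) :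
    ent P (fun ω => (B ω, A ω)) - ent P B ≤
      ent P (fun ω => (h (B ω), A ω)) - ent P (fun ω => h (B ω)) := by
  have h1 := ent_submodular hP A B fun ω => h (B ω)
  rw [ent_congr (f := fun ω => (A ω, B ω, h (B ω))) (g := fun ω => (B ω, A ω)) (by
      intro ω ω' _ _; simp only [Prod.mk.injEq]; constructor <;> rintro ⟨h1, h2⟩ <;> simp_all),
    ent_congr (f := fun ω => (A ω, h (B ω))) (g := fun ω => (h (B ω), A ω)) (by
      intro ω ω' _ _; simp only [Prod.mk.injEq]; tauto),
    ent_congr (f := fun ω => (B ω, h (B ω))) (g := B) (by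
      intro ω ω' _ _; simp only [Prod.mk.injEq]
      exact ⟨fun h => h.1, fun e => ⟨e, by rw [e]⟩⟩)] at h1
  linarith

end Entropy

/-! ### Convex hulls in finite dimension -/

section ConvexHull

theorem sum_extend_zero {ι κ F : Type*} [Fintype ι] [Fintype κ] [AddCommMonoid F] (e : ι ↪ κ)
    (f : ι → F) : ∑ j, Function.extend e f 0 j = ∑ i, f i := by
  rw [← Finset.sum_subset (Finset.subset_univ (Finset.univ.map e))]
  · rw [Finset.sum_map]
    exact Finset.sum_congr rfl fun i _ => e.injective.extend_apply _ _ _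
  · intro j _ hj
    rw [Function.extend_apply', Pi.zero_apply]
    rintro ⟨i, rfl⟩
    exact hj (Finset.mem_map_of_mem _ (Finset.mem_univ _))

variable {E : Type*} [AddCommGroup E] [Module ℝ E] [FiniteDimensional ℝ E]

/-- Carathéodory's theorem with a fixed number of points. -/
theorem exists_sum_fin_of_mem_convexHull {s : Set E} {x : E} (hx : x ∈ convexHull ℝ s) :
    ∃ w ∈ stdSimplex ℝ (Fin (Module.finrank ℝ E + 1)), ∃ z : Fin (Module.finrank ℝ E + 1) → E,
      (∀ i, z i ∈ s) ∧ ∑ i, w i • z i = x := by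
  classical
  obtain ⟨x₀, hx₀⟩ := convexHull_nonempty_iff.1 ⟨x, hx⟩
  obtain ⟨ι, _, z, w, hz, hind, hw, hw1, hsum⟩ := eq_pos_convex_span_of_mem_convexHull hx
  have hcard : Fintype.card ι ≤ Fintype.card (Fin (Module.finrank ℝ E + 1)) := by
    rw [Fintype.card_fin]
    refine hind.card_le_finrank_succ.trans ?_
    exact Nat.succ_le_succ (Submodule.finrank_le _)
  obtain ⟨e⟩ := Function.Embedding.nonempty_of_card_le hcard
  -- Pad the list to the fixed length with weight zero on an arbitrary point `x₀` of `s`.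
  refine ⟨Function.extend e w 0, ⟨fun j => ?_, ?_⟩, Function.extend e z fun _ => x₀,
    fun j => ?_, ?_⟩
  · by_cases hj : ∃ i, e i = j
    · obtain ⟨i, rfl⟩ := hj
      rw [e.injective.extend_apply]; exact (hw i).le
    · rw [Function.extend_apply' _ _ _ hj]; rfl
  · rw [sum_extend_zero, hw1]
  · by_cases hj : ∃ i, e i = j
    · obtain ⟨i, rfl⟩ := hj
      rw [e.injective.extend_apply]; exact hz ⟨i, rfl⟩
    · rw [Function.extend_apply' _ _ _ hj]; exact hx₀
  · rw [← hsum, ← sum_extend_zero e]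
    refine Finset.sum_congr rfl fun j _ => ?_
    by_cases hj : ∃ i, e i = j
    · obtain ⟨i, rfl⟩ := hj
      simp only [e.injective.extend_apply]
    · simp [Function.extend_apply' _ _ _ hj]

/-- With the number of points bounded by Carathéodory, the hull is the continuous image of a simplex
times a finite power of `s`. -/
theorem isCompact_convexHull_of_isCompact [TopologicalSpace E] [IsTopologicalAddGroup E]
    [ContinuousSMul ℝ E] {s : Set E} (hs : IsCompact s) : IsCompact (convexHull ℝ s) := by
  have h := (isCompact_stdSimplex ℝ (Fin (Module.finrank ℝ E + 1))).prod
    (isCompact_univ_pi fun _ : Fin (Module.finrank ℝ E + 1) => hs)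
  have h' := h.image (f := fun t : (Fin (Module.finrank ℝ E + 1) → ℝ) ×
    (Fin (Module.finrank ℝ E + 1) → E) => ∑ i, t.1 i • t.2 i) (by fun_prop)
  convert h' using 1
  ext x
  constructor
  · intro hx
    obtain ⟨w, hw, z, hz, rfl⟩ := exists_sum_fin_of_mem_convexHull hx
    exact ⟨(w, z), ⟨hw, fun i _ => hz i⟩, rfl⟩
  · rintro ⟨⟨w, z⟩, ⟨hw, hz⟩, rfl⟩
    exact (convex_convexHull ℝ s).sum_mem (fun i _ => hw.1 i) hw.2
      fun i _ => subset_convexHull ℝ s (hz i trivial)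

end ConvexHull

/-! ### A single-letter region in terms of convex hulls -/

section Region

variable {X Y Z : Type*} [Fintype Y] [Fintype Z]

/-- The marginal channel to the first receiver. -/
def Channel.toY (p : Channel X Y Z) (x : X) (y : Y) : ℝ := ∑ z, p.prob x (y, z)

/-- The marginal channel to the second receiver. -/
def Channel.toZ (p : Channel X Y Z) (x : X) (z : Z) : ℝ := ∑ y, p.prob x (y, z)

theorem Channel.toY_mem (p : Channel X Y Z) (x : X) : p.toY x ∈ stdSimplex ℝ Y :=
  ⟨fun _ => Finset.sum_nonneg fun _ _ => (p.prob_mem x).1 _, by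
    simp only [toY]; rw [← Fintype.sum_prod_type]; exact (p.prob_mem x).2⟩

theorem Channel.toZ_mem (p : Channel X Y Z) (x : X) : p.toZ x ∈ stdSimplex ℝ Z :=
  ⟨fun _ => Finset.sum_nonneg fun _ _ => (p.prob_mem x).1 _, by
    simp only [toZ]; rw [Finset.sum_comm, ← Fintype.sum_prod_type]; exact (p.prob_mem x).2⟩

variable [Fintype X]

/-- The entropy of the output of the kernel `W` when the input has law `q`. -/
def outEnt (W : X → Y → ℝ) (q : X → ℝ) : ℝ := ∑ y, Real.negMulLog (∑ x, q x * W x y)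

/-- The entropy of the output given the input. -/
def noiseEnt (W : X → Y → ℝ) (q : X → ℝ) : ℝ := ∑ x, q x * ∑ y, Real.negMulLog (W x y)

/-- The convex hull of the graph of the two output entropies. -/
def entHull (W : X → Y → ℝ) (W' : X → Z → ℝ) : Set ((X → ℝ) × ℝ × ℝ) :=
  convexHull ℝ ((fun q => (q, outEnt W q, outEnt W' q)) '' stdSimplex ℝ X)

theorem continuous_outEnt (W : X → Y → ℝ) : Continuous (outEnt W) := by
  unfold outEnt
  exact continuous_finsetSum _ fun y _ => Real.continuous_negMulLog.comp (by fun_prop)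

theorem isCompact_entHull (W : X → Y → ℝ) (W' : X → Z → ℝ) : IsCompact (entHull W W') := by
  refine isCompact_convexHull_of_isCompact ((isCompact_stdSimplex ℝ X).image ?_)
  exact continuous_id.prodMk ((continuous_outEnt W).prodMk (continuous_outEnt W'))

theorem entHull_fst_mem {W : X → Y → ℝ} {W' : X → Z → ℝ} {t : (X → ℝ) × ℝ × ℝ}
    (ht : t ∈ entHull W W') : t.1 ∈ stdSimplex ℝ X := by
  have h : entHull W W' ⊆ (LinearMap.fst ℝ (X → ℝ) (ℝ × ℝ)) ⁻¹' stdSimplex ℝ X := by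
    refine convexHull_min ?_ ((convex_stdSimplex ℝ X).linear_preimage _)
    rintro _ ⟨q, hq, rfl⟩
    exact hq
  exact h ht

/-- The rate pairs satisfying the bounds of `regionX`, written with the input law `q` of `X`,
`a = H(Y|U)`, `b = H(Z|U)`, `a' = H(Z|V)`, `b' = H(Y|V)`. -/
def hullRegion (p : Channel X Y Z) : Set (ℝ × ℝ) :=
  {R | ∃ (q : X → ℝ) (a b a' b' : ℝ), (q, a, b) ∈ entHull p.toY p.toZ ∧
    (q, a', b') ∈ entHull p.toZ p.toY ∧
    R.1 * Real.log 2 ≤ outEnt p.toY q - a ∧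
    R.2 * Real.log 2 ≤ outEnt p.toZ q - a' ∧
    (R.1 + R.2) * Real.log 2 ≤ outEnt p.toY q - a + b - noiseEnt p.toZ q ∧
    (R.1 + R.2) * Real.log 2 ≤ outEnt p.toZ q - a' + b' - noiseEnt p.toY q}

/-- The witnesses range over a compact set and the constraints are closed, and projection along a
compact factor is a closed map. This absorbs both the limit in the block length and the closure in
the capacity region. -/
theorem isClosed_hullRegion (p : Channel X Y Z) : IsClosed (hullRegion p) := by
  set C := entHull p.toY p.toZ ×ˢ entHull p.toZ p.toY with hC
  have : CompactSpace C :=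
    isCompact_iff_compactSpace.1 ((isCompact_entHull _ _).prod (isCompact_entHull _ _))
  have hY := continuous_outEnt p.toY
  have hZ := continuous_outEnt p.toZ
  have hnY : Continuous (noiseEnt p.toY) := by unfold noiseEnt; fun_prop
  have hnZ : Continuous (noiseEnt p.toZ) := by unfold noiseEnt; fun_prop
  let D : Set (C × (ℝ × ℝ)) := {t | t.1.1.1.1 = t.1.1.2.1 ∧
    t.2.1 * Real.log 2 ≤ outEnt p.toY t.1.1.1.1 - t.1.1.1.2.1 ∧
    t.2.2 * Real.log 2 ≤ outEnt p.toZ t.1.1.1.1 - t.1.1.2.2.1 ∧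
    (t.2.1 + t.2.2) * Real.log 2 ≤
      outEnt p.toY t.1.1.1.1 - t.1.1.1.2.1 + t.1.1.1.2.2 - noiseEnt p.toZ t.1.1.1.1 ∧
    (t.2.1 + t.2.2) * Real.log 2 ≤
      outEnt p.toZ t.1.1.1.1 - t.1.1.2.2.1 + t.1.1.2.2.2 - noiseEnt p.toY t.1.1.1.1}
  have hD : IsClosed D := by
    simp only [D, Set.ofPred_and]
    refine (isClosed_eq ?_ ?_).inter <| (isClosed_le ?_ ?_).inter <| (isClosed_le ?_ ?_).inter <|
      (isClosed_le ?_ ?_).inter (isClosed_le ?_ ?_) <;> fun_prop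
  convert isClosedMap_snd_of_compactSpace D hD using 1
  ext R
  constructor
  · rintro ⟨q, a, b, a', b', h1, h2, h3⟩
    exact ⟨(⟨((q, a, b), (q, a', b')), h1, h2⟩, R), ⟨rfl, h3⟩, rfl⟩
  · rintro ⟨⟨⟨⟨⟨q, a, b⟩, ⟨q', a', b'⟩⟩, h1, h2⟩, R'⟩, ⟨hq, h3⟩, rfl⟩
    obtain rfl : q = q' := hq
    exact ⟨q, a, b, a', b', h1, h2, h3⟩

end Region

/-! ### Entropies along Markov chains `U → ξ → η` -/

section Markov

variable {Ω α X Y Z : Type*} [Fintype Ω] {P : Ω → ℝ}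

/-- Given `ξ`, the variable `η` is independent of `U` and has law `W ξ`. -/
def IsMarkov (P : Ω → ℝ) (U : Ω → α) (ξ : Ω → X) (η : Ω → Y) (W : X → Y → ℝ) : Prop :=
  ∀ u x y, law P (fun ω => (U ω, ξ ω, η ω)) (u, x, y) = law P (fun ω => (U ω, ξ ω)) (u, x) * W x y

/-- Once the mass factors as `r(γ) p(y,z|x(γ))`, summing out the other output leaves the marginal
kernel. It serves both the single-letter joint law and each channel use of a code. -/
theorem isMarkov_toY [Fintype Y] [Fintype Z] {Γ : Type*} [Fintype Γ] (p : Channel X Y Z)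
    (e : Ω ≃ Γ × Y × Z) (r : Γ → ℝ) (x : Γ → X)
    (hP : ∀ ω, P ω = r (e ω).1 * p.prob (x (e ω).1) (e ω).2) (h : Γ → α) :
    IsMarkov P (fun ω => h (e ω).1) (fun ω => x (e ω).1) (fun ω => (e ω).2.1) p.toY := by
  classical
  intro u x₀ y₀
  unfold law
  rw [← e.symm.sum_comp, ← e.symm.sum_comp]
  simp only [hP, Equiv.apply_symm_apply, Fintype.sum_prod_type, Prod.mk.injEq]
  rw [Finset.sum_mul]
  refine Finset.sum_congr rfl fun γ _ => ?_
  by_cases h1 : h γ = u ∧ x γ = x₀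
  · obtain ⟨rfl, rfl⟩ := h1
    have := (p.prob_mem (x γ)).2
    rw [Fintype.sum_prod_type] at this
    simp only [true_and, if_true, ← Finset.mul_sum, this, mul_one, Channel.toY]
    rw [Finset.sum_eq_single y₀ (by intro b _ hb; simp [hb]) (by simp)]
    simp [Finset.mul_sum]
  · have h2 : ∀ y, ¬ (h γ = u ∧ x γ = x₀ ∧ y = y₀) := fun y hy => h1 ⟨hy.1, hy.2.1⟩
    simp [h1, h2]

theorem isMarkov_toZ [Fintype Y] [Fintype Z] {Γ : Type*} [Fintype Γ] (p : Channel X Y Z)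
    (e : Ω ≃ Γ × Y × Z) (r : Γ → ℝ) (x : Γ → X)
    (hP : ∀ ω, P ω = r (e ω).1 * p.prob (x (e ω).1) (e ω).2) (h : Γ → α) :
    IsMarkov P (fun ω => h (e ω).1) (fun ω => x (e ω).1) (fun ω => (e ω).2.2) p.toZ := by
  classical
  intro u x₀ z₀
  unfold law
  rw [← e.symm.sum_comp, ← e.symm.sum_comp]
  simp only [hP, Equiv.apply_symm_apply, Fintype.sum_prod_type, Prod.mk.injEq]
  rw [Finset.sum_mul]
  refine Finset.sum_congr rfl fun γ _ => ?_
  by_cases h1 : h γ = u ∧ x γ = x₀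
  · obtain ⟨rfl, rfl⟩ := h1
    have := (p.prob_mem (x γ)).2
    rw [Fintype.sum_prod_type] at this
    simp only [true_and, if_true, ← Finset.mul_sum, this, mul_one, Channel.toZ]
    simp [Finset.mul_sum]
  · have h2 : ∀ z, ¬ (h γ = u ∧ x γ = x₀ ∧ z = z₀) := fun y hy => h1 ⟨hy.1, hy.2.1⟩
    simp [h1, h2]

variable {U : Ω → α} {ξ : Ω → X} {η : Ω → Y} {ζ : Ω → Z} {W : X → Y → ℝ} {W' : X → Z → ℝ}
variable [Fintype X]

theorem IsMarkov.law_pair (h : IsMarkov P U ξ η W) (u : α) (y : Y) :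
    law P (fun ω => (U ω, η ω)) (u, y) = ∑ x, law P (fun ω => (U ω, ξ ω)) (u, x) * W x y := by
  simp only [← h u]
  rw [← sum_law_prod_left P ξ (fun ω => (U ω, η ω)) (u, y)]
  refine Finset.sum_congr rfl fun x _ => law_congr P fun ω _ => ?_
  simp only [Prod.mk.injEq]; tauto

variable [Fintype α]

theorem IsMarkov.law_out (h : IsMarkov P U ξ η W) (y : Y) :
    law P η y = ∑ x, law P ξ x * W x y := by
  rw [← sum_law_prod_left P U η y]
  simp only [h.law_pair]
  rw [Finset.sum_comm]
  refine Finset.sum_congr rfl fun x _ => ?_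
  rw [← Finset.sum_mul, sum_law_prod_left]

theorem IsMarkov.ent_out [Fintype Y] (h : IsMarkov P U ξ η W) :
    ent P η = outEnt W (law P ξ) := by
  rw [ent_eq_sum_negMulLog]
  simp only [h.law_out]
  rfl

/-- By `negMulLog (a * b) = b * negMulLog a + a * negMulLog b`, the first terms sum to `H(U)` and
cancel. The factorization `w u * q u x` is left free so that it covers conditional laws and the pad
construction alike. -/
theorem IsMarkov.ent_pair_sub [Fintype Y] (h : IsMarkov P U ξ η W)
    (hW : ∀ x, W x ∈ stdSimplex ℝ Y) {w : α → ℝ} {q : α → X → ℝ}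
    (hq : ∀ u, q u ∈ stdSimplex ℝ X) (hl : ∀ u x, law P (fun ω => (U ω, ξ ω)) (u, x) = w u * q u x) :
    ent P (fun ω => (U ω, η ω)) - ent P U = ∑ u, w u * outEnt W (q u) := by
  have hU : ∀ u, law P U u = w u := fun u => by
    rw [← sum_law_prod_right P U ξ u]
    simp only [hl, ← Finset.mul_sum, (hq u).2, mul_one]
  rw [ent_eq_sum_negMulLog, ent_eq_sum_negMulLog, Fintype.sum_prod_type,
    ← Finset.sum_sub_distrib]
  refine Finset.sum_congr rfl fun u _ => ?_
  simp only [hU, h.law_pair, hl, mul_assoc, ← Finset.mul_sum, Real.negMulLog_mul,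
    Finset.sum_add_distrib, ← Finset.sum_mul]
  have : ∑ y, ∑ x, q u x * W x y = 1 := by
    rw [Finset.sum_comm]
    simp only [← Finset.mul_sum, (hW _).2, mul_one, (hq u).2]
  rw [this, one_mul, add_sub_cancel_left]
  rfl

/-- Same cancellation, with the rows of `W` as conditional laws; the result no longer depends on
`U`. -/
theorem IsMarkov.ent_triple_sub [Fintype Y] (h : IsMarkov P U ξ η W)
    (hW : ∀ x, W x ∈ stdSimplex ℝ Y) :
    ent P (fun ω => (U ω, ξ ω, η ω)) - ent P (fun ω => (U ω, ξ ω)) = noiseEnt W (law P ξ) := by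
  rw [ent_eq_sum_negMulLog, ent_eq_sum_negMulLog]
  simp only [Fintype.sum_prod_type, h _ _ _, Real.negMulLog_mul, Finset.sum_add_distrib,
    ← Finset.sum_mul, (hW _).2, one_mul, add_sub_cancel_left, ← Finset.mul_sum]
  rw [Finset.sum_comm]
  refine Finset.sum_congr rfl fun x _ => ?_
  rw [← Finset.sum_mul, sum_law_prod_left]

theorem law_mem_stdSimplex (hP : P ∈ stdSimplex ℝ Ω) (ξ : Ω → X) : law P ξ ∈ stdSimplex ℝ X :=
  ⟨law_nonneg hP.1 ξ, by rw [sum_law, hP.2]⟩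

/-- The triple is the average, with weights the law of `U`, of the graph points at the conditional
laws of `ξ`. -/
theorem IsMarkov.mem_entHull [Fintype Y] [Fintype Z] (hP : P ∈ stdSimplex ℝ Ω)
    (h : IsMarkov P U ξ η W) (h' : IsMarkov P U ξ ζ W') (hW : ∀ x, W x ∈ stdSimplex ℝ Y)
    (hW' : ∀ x, W' x ∈ stdSimplex ℝ Z) :
    (law P ξ, ent P (fun ω => (U ω, η ω)) - ent P U, ent P (fun ω => (U ω, ζ ω)) - ent P U) ∈
      entHull W W' := by
  classical
  -- Values of `U` with zero mass carry zero weight, so any probability vector will do there.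
  let q : α → X → ℝ := fun u => if law P U u = 0 then law P ξ else
    fun x => law P (fun ω => (U ω, ξ ω)) (u, x) / law P U u
  have hl : ∀ u x, law P (fun ω => (U ω, ξ ω)) (u, x) = law P U u * q u x := fun u x => by
    by_cases h0 : law P U u = 0
    · rw [h0, zero_mul]
      exact law_eq_zero_of_comp hP.1 (fun ω => (U ω, ξ ω)) Prod.fst h0
    · simp only [q, h0, if_false]
      rw [mul_div_cancel₀ _ h0]
  have hq : ∀ u, q u ∈ stdSimplex ℝ X := fun u => by
    by_cases h0 : law P U u = 0
    · simp only [q, h0, if_true]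
      exact law_mem_stdSimplex hP ξ
    · simp only [q, h0, if_false]
      refine ⟨fun x => div_nonneg (law_nonneg hP.1 _ _) (law_nonneg hP.1 _ _), ?_⟩
      rw [← Finset.sum_div, sum_law_prod_right, div_self h0]
  have hw := law_mem_stdSimplex hP U
  have := (convex_convexHull ℝ ((fun q => (q, outEnt W q, outEnt W' q)) '' stdSimplex ℝ X)).sum_mem
    (t := Finset.univ) (fun u _ => hw.1 u) hw.2
    (fun u _ => subset_convexHull ℝ _ (Set.mem_image_of_mem _ (hq u)))
  rw [h.ent_pair_sub hW hq hl, h'.ent_pair_sub hW' hq hl]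
  unfold entHull
  convert this using 1
  refine Prod.ext ?_ (Prod.ext ?_ ?_)
  · ext x
    simp only [Prod.fst_sum, Finset.sum_apply, Prod.smul_mk, Pi.smul_apply, smul_eq_mul]
    rw [← sum_law_prod_left P U ξ x]
    exact Finset.sum_congr rfl fun u _ => hl u x
  · simp [Prod.fst_sum, Prod.snd_sum]
  · simp [Prod.snd_sum]

end Markov

/-! ### The bounds in terms of the hull region -/

section Aux

variable {U V X Y Z : Type*} [Fintype U] [Fintype V] [Fintype X] [Fintype Y] [Fintype Z]

theorem AuxInput.joint_mem (q : AuxInput U V X) (p : Channel X Y Z) :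
    q.joint p ∈ stdSimplex ℝ (U × V × X × Y × Z) := by
  refine ⟨fun ω => mul_nonneg (mul_nonneg (q.pUV_mem.1 _) ((q.pX_mem _ _).1 _))
    ((p.prob_mem _).1 _), ?_⟩
  have h1 : ∀ x, ∑ y, ∑ z, p.prob x (y, z) = 1 := fun x => by
    rw [← Fintype.sum_prod_type]; exact (p.prob_mem x).2
  have h2 := q.pUV_mem.2
  rw [Fintype.sum_prod_type] at h2
  simp only [Fintype.sum_prod_type, joint, ← Finset.mul_sum, h1, mul_one, (q.pX_mem _ _).2, h2]

/-- Separates the inputs from the outputs. -/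
def jointEquiv : U × V × X × Y × Z ≃ (U × V × X) × Y × Z where
  toFun ω := ((ω.1, ω.2.1, ω.2.2.1), ω.2.2.2)
  invFun ω := (ω.1.1, ω.1.2.1, ω.1.2.2, ω.2)
  left_inv _ := rfl
  right_inv _ := rfl

theorem AuxInput.isMarkov_Y {α : Type*} (q : AuxInput U V X) (p : Channel X Y Z) (h : U × V → α) :
    IsMarkov (q.joint p) (fun ω => h (rvU ω, rvV ω)) rvX rvY p.toY :=
  isMarkov_toY p jointEquiv (fun γ => q.pUV (γ.1, γ.2.1) * q.pX γ.1 γ.2.1 γ.2.2)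
    (fun γ => γ.2.2) (fun _ => rfl) (fun γ => h (γ.1, γ.2.1))

theorem AuxInput.isMarkov_Z {α : Type*} (q : AuxInput U V X) (p : Channel X Y Z) (h : U × V → α) :
    IsMarkov (q.joint p) (fun ω => h (rvU ω, rvV ω)) rvX rvZ p.toZ :=
  isMarkov_toZ p jointEquiv (fun γ => q.pUV (γ.1, γ.2.1) * q.pX γ.1 γ.2.1 γ.2.2)
    (fun γ => γ.2.2) (fun _ => rfl) (fun γ => h (γ.1, γ.2.1))

theorem ent_swap {Ω α β : Type*} [Fintype Ω] (P : Ω → ℝ) (f : Ω → α) (g : Ω → β) :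
    ent P (fun ω => (f ω, g ω)) = ent P (fun ω => (g ω, f ω)) :=
  ent_congr fun _ _ _ _ => by simp only [Prod.mk.injEq]; tauto

theorem ent_rotate {Ω α β γ : Type*} [Fintype Ω] (P : Ω → ℝ) (f : Ω → α) (g : Ω → β)
    (h : Ω → γ) : ent P (fun ω => (f ω, g ω, h ω)) = ent P (fun ω => (h ω, f ω, g ω)) :=
  ent_congr fun _ _ _ _ => by simp only [Prod.mk.injEq]; tauto

/-- `I(ξ;η|U) = H(η|U) - H(η|ξ)` along a Markov chain `U → ξ → η`. -/
theorem IsMarkov.condMutualInfo_mul_log {Ω α : Type*} [Fintype Ω] [Fintype α] {P : Ω → ℝ}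
    (hP : ∀ ω, 0 ≤ P ω)
    {U : Ω → α} {ξ : Ω → X} {η : Ω → Y} {W : X → Y → ℝ} (h : IsMarkov P U ξ η W)
    (hW : ∀ x, W x ∈ stdSimplex ℝ Y) :
    condMutualInfo P ξ η U * Real.log 2 =
      ent P (fun ω => (U ω, η ω)) - ent P U - noiseEnt W (law P ξ) := by
  rw [BCOuter.condMutualInfo_mul_log hP, ent_swap P ξ, ent_swap P η, ent_rotate P ξ,
    ← h.ent_triple_sub hW]
  ring

/-- Membership in `regionX` in terms of entropies. -/
theorem AuxInput.mem_regionX_iff (q : AuxInput U V X) (p : Channel X Y Z) (R : ℝ × ℝ) :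
    R ∈ q.regionX p ↔
      R.1 * Real.log 2 ≤ outEnt p.toY (law (q.joint p) rvX) -
        (ent (q.joint p) (fun ω => (rvU ω, rvY ω)) - ent (q.joint p) rvU) ∧
      R.2 * Real.log 2 ≤ outEnt p.toZ (law (q.joint p) rvX) -
        (ent (q.joint p) (fun ω => (rvV ω, rvZ ω)) - ent (q.joint p) rvV) ∧
      (R.1 + R.2) * Real.log 2 ≤ outEnt p.toY (law (q.joint p) rvX) -
        (ent (q.joint p) (fun ω => (rvU ω, rvY ω)) - ent (q.joint p) rvU) +
        (ent (q.joint p) (fun ω => (rvU ω, rvZ ω)) - ent (q.joint p) rvU) -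
        noiseEnt p.toZ (law (q.joint p) rvX) ∧
      (R.1 + R.2) * Real.log 2 ≤ outEnt p.toZ (law (q.joint p) rvX) -
        (ent (q.joint p) (fun ω => (rvV ω, rvZ ω)) - ent (q.joint p) rvV) +
        (ent (q.joint p) (fun ω => (rvV ω, rvY ω)) - ent (q.joint p) rvV) -
        noiseEnt p.toY (law (q.joint p) rvX) := by
  have hP := (q.joint_mem p).1
  have hl : 0 < Real.log 2 := Real.log_pos one_lt_two
  have e1 := mutualInfo_mul_log hP (rvU (U := U)) (rvY (Y := Y))
  have e2 := mutualInfo_mul_log hP (rvV (V := V)) (rvZ (Z := Z))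
  have e3 := (q.isMarkov_Z p Prod.fst).condMutualInfo_mul_log hP p.toZ_mem
  have e4 := (q.isMarkov_Y p Prod.snd).condMutualInfo_mul_log hP p.toY_mem
  have e5 := (q.isMarkov_Y p id).ent_out
  have e6 := (q.isMarkov_Z p id).ent_out
  change condMutualInfo (q.joint p) rvX rvZ rvU * _ = _ at e3
  change condMutualInfo (q.joint p) rvX rvY rvV * _ = _ at e4
  unfold regionX
  rw [Set.mem_ofPred_eq, ← mul_le_mul_iff_left₀ hl, ← mul_le_mul_iff_left₀ hl (b := R.2),
    ← mul_le_mul_iff_left₀ hl (b := R.1 + R.2), ← mul_le_mul_iff_left₀ hl (b := R.1 + R.2),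
    add_mul (mutualInfo _ _ _), add_mul (mutualInfo _ _ _), e1, e2, e3, e4, e5, e6]
  refine and_congr ?_ (and_congr ?_ (and_congr ?_ ?_)) <;>
    exact ⟨fun h => by linarith, fun h => by linarith⟩

theorem outerBoundX_subset_hullRegion (p : Channel X Y Z) : outerBoundX p ⊆ hullRegion p := by
  rintro R ⟨U, V, _, _, q, hR⟩
  rw [q.mem_regionX_iff] at hR
  exact ⟨_, _, _, _, _,
    (q.isMarkov_Y p Prod.fst).mem_entHull (q.joint_mem p) (q.isMarkov_Z p Prod.fst)
      p.toY_mem p.toZ_mem,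
    (q.isMarkov_Z p Prod.snd).mem_entHull (q.joint_mem p) (q.isMarkov_Y p Prod.snd)
      p.toZ_mem p.toY_mem, hR⟩

/-- Data processing: `I(A;η|B) ≤ I(ξ;η|B)` when `(A,B) → ξ → η`, with equality if `ξ` is
determined by `(A,B)`. -/
theorem condMutualInfo_le_of_isMarkov {Ω α β : Type*} [Fintype Ω] [Fintype α] [Fintype β]
    {P : Ω → ℝ} (hP : ∀ ω, 0 ≤ P ω) {A : Ω → α} {B : Ω → β} {ξ : Ω → X} {η : Ω → Y}
    {W : X → Y → ℝ} (h : IsMarkov P (fun ω => (A ω, B ω)) ξ η W) (h' : IsMarkov P B ξ η W)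
    (hW : ∀ x, W x ∈ stdSimplex ℝ Y) :
    condMutualInfo P A η B ≤ condMutualInfo P ξ η B := by
  have hl : 0 < Real.log 2 := Real.log_pos one_lt_two
  rw [← mul_le_mul_iff_left₀ hl, h'.condMutualInfo_mul_log hP hW, condMutualInfo_mul_log hP,
    ← h.ent_triple_sub hW]
  have h1 := ent_sub_le_of_comp hP η (fun ω => ((A ω, B ω), ξ ω)) Prod.fst
  rw [ent_congr (f := fun ω => (((A ω, B ω), ξ ω), η ω)) (g := fun ω => ((A ω, B ω), ξ ω, η ω))
    (fun _ _ _ _ => by simp only [Prod.mk.injEq]; tauto)] at h1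
  rw [ent_congr (f := fun ω => (A ω, η ω, B ω)) (g := fun ω => ((A ω, B ω), η ω))
    (fun _ _ _ _ => by simp only [Prod.mk.injEq]; tauto), ent_swap P η]
  linarith

/-- If `(A, B)` determines `ξ` on the support, adjoining `ξ` to the conditioning changes nothing, so
data processing loses nothing. -/
theorem condMutualInfo_eq_of_isMarkov {Ω α β : Type*} [Fintype Ω] [Fintype α] [Fintype β]
    {P : Ω → ℝ} (hP : ∀ ω, 0 ≤ P ω) {A : Ω → α} {B : Ω → β} {ξ : Ω → X} {η : Ω → Y}
    {W : X → Y → ℝ} (h : IsMarkov P (fun ω => (A ω, B ω)) ξ η W) (h' : IsMarkov P B ξ η W)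
    (hW : ∀ x, W x ∈ stdSimplex ℝ Y)
    (hdet : ∀ ω ω', P ω ≠ 0 → P ω' ≠ 0 → A ω' = A ω → B ω' = B ω → ξ ω' = ξ ω) :
    condMutualInfo P A η B = condMutualInfo P ξ η B := by
  have hl : Real.log 2 ≠ 0 := (Real.log_pos one_lt_two).ne'
  refine mul_right_cancel₀ hl ?_
  rw [h'.condMutualInfo_mul_log hP hW, condMutualInfo_mul_log hP, ← h.ent_triple_sub hW]
  rw [ent_congr (f := fun ω => ((A ω, B ω), ξ ω, η ω)) (g := fun ω => (A ω, η ω, B ω))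
    (fun ω ω' h1 h2 => by simp only [Prod.mk.injEq]; have := hdet ω ω' h1 h2; tauto),
    ent_congr (f := fun ω => ((A ω, B ω), ξ ω)) (g := fun ω => (A ω, B ω))
    (fun ω ω' h1 h2 => by simp only [Prod.mk.injEq]; have := hdet ω ω' h1 h2; tauto),
    ent_swap P η]
  ring

theorem outerBound_subset_outerBoundX (p : Channel X Y Z) : outerBound p ⊆ outerBoundX p := by
  rintro R ⟨U, V, _, _, q, h1, h2, h3, h4⟩
  have hP := (q.joint_mem p).1
  refine ⟨U, V, _, _, q, h1, h2, h3.trans ?_, h4.trans ?_⟩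
  · exact (add_le_add_iff_left _).2 <|
      condMutualInfo_le_of_isMarkov hP (q.isMarkov_Z p Prod.swap) (q.isMarkov_Z p Prod.fst) p.toZ_mem
  · exact (add_le_add_iff_left _).2 <|
      condMutualInfo_le_of_isMarkov hP (q.isMarkov_Y p id) (q.isMarkov_Y p Prod.snd) p.toY_mem

theorem outerBoundXDet_subset_outerBound (p : Channel X Y Z) : outerBoundXDet p ⊆ outerBound p := by
  rintro R ⟨U, V, _, _, q, hq, h1, h2, h3, h4⟩
  have hP := (q.joint_mem p).1
  have hone : ∀ ω, q.joint p ω ≠ 0 → q.pX (rvU ω) (rvV ω) (rvX ω) = 1 := fun ω h =>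
    (hq _ _ _).resolve_left fun h0 => h (by
      obtain ⟨u, v, x, y, z⟩ := ω
      change q.pX u v x = 0 at h0
      simp [AuxInput.joint, h0])
  -- Two distinct letters of conditional probability one would give total mass at least two.
  have huniq : ∀ u v x x', q.pX u v x = 1 → q.pX u v x' = 1 → x = x' := fun u v x x' hx hx' => by
    classical
    by_contra hne
    have hs := Finset.sum_le_sum_of_subset_of_nonneg (Finset.subset_univ {x, x'})
      fun i _ _ => (q.pX_mem u v).1 i
    rw [Finset.sum_pair hne, (q.pX_mem u v).2, hx, hx'] at hs
    norm_num at hs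
  have hdet : ∀ ω ω', q.joint p ω ≠ 0 → q.joint p ω' ≠ 0 → rvU ω' = rvU ω → rvV ω' = rvV ω →
      rvX ω' = rvX ω := fun ω ω' hω hω' hu hv => by
    have := hone ω' hω'
    rw [hu, hv] at this
    exact huniq _ _ _ _ this (hone ω hω)
  refine ⟨U, V, _, _, q, h1, h2, h3.trans_eq ?_, h4.trans_eq ?_⟩
  · rw [← condMutualInfo_eq_of_isMarkov hP (q.isMarkov_Z p Prod.swap) (q.isMarkov_Z p Prod.fst)
      p.toZ_mem fun ω ω' h h' hv hu => hdet ω ω' h h' hu hv]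
  · rw [← condMutualInfo_eq_of_isMarkov hP (q.isMarkov_Y p id) (q.isMarkov_Y p Prod.snd)
      p.toY_mem hdet]

end Aux

/-! ### The one-time pad coupling -/

section Pad

variable {ι κ G X Y Z : Type*} [Fintype ι] [Fintype κ] [Fintype G] [AddCommGroup G]
  [Fintype X] [Fintype Y] [Fintype Z]

/-- With one share fixed, the other makes `e (a + b)` run once through `X`: this is the secrecy of
the pad. -/
theorem sum_pad_left (e : G ≃ X) (a : G) (F : X → ℝ) : ∑ b, F (e (a + b)) = ∑ x, F x :=
  ((Equiv.addLeft a).trans e).sum_comp F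

theorem sum_pad_right (e : G ≃ X) (b : G) (F : X → ℝ) : ∑ a, F (e (a + b)) = ∑ x, F x :=
  ((Equiv.addRight b).trans e).sum_comp F

open Classical in
/-- Given laws `f` of `(I, X)` and `f'` of `(J, X)` with the same marginal `q` of `X`, let `I` and
`J` be conditionally independent given `X`, and hide `X` in two shares, each of which is
independent of `(I, J, X)`: then `X` is a function of `U = (I, share)` and `V = (J, share)`. -/
def padInput (e : G ≃ X) (f : ι → X → ℝ) (f' : κ → X → ℝ) (q : X → ℝ) (hf : ∀ i x, 0 ≤ f i x)
    (hf' : ∀ j x, 0 ≤ f' j x) (hq : q ∈ stdSimplex ℝ X) (hfq : ∀ x, ∑ i, f i x = q x)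
    (hfq' : ∀ x, ∑ j, f' j x = q x) : AuxInput (ι × G) (κ × G) X where
  -- The share is uniform given `(I, J, X)`, whence the factor `1/|G|`; the rest is the
  -- conditionally independent coupling, zero by convention where `q` vanishes.
  pUV t := (Fintype.card G : ℝ)⁻¹ * (f t.1.1 (e (t.1.2 + t.2.2)) * f' t.2.1 (e (t.1.2 + t.2.2)) /
    q (e (t.1.2 + t.2.2)))
  pUV_mem := by
    refine ⟨fun t => mul_nonneg (by positivity) (div_nonneg (mul_nonneg (hf _ _) (hf' _ _))
      (hq.1 _)), ?_⟩
    have hcard : (Fintype.card G : ℝ) ≠ 0 := by simp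
    simp only [Fintype.sum_prod_type]
    have h1 : ∀ i a, ∑ j, ∑ b, (Fintype.card G : ℝ)⁻¹ *
        (f i (e (a + b)) * f' j (e (a + b)) / q (e (a + b))) =
        (Fintype.card G : ℝ)⁻¹ * ∑ x, f i x * (q x / q x) := fun i a => by
      rw [Finset.sum_comm, sum_pad_left e a fun x => ∑ j, (Fintype.card G : ℝ)⁻¹ *
        (f i x * f' j x / q x), Finset.mul_sum]
      refine Finset.sum_congr rfl fun x _ => ?_
      rw [← Finset.mul_sum, ← Finset.sum_div, ← Finset.mul_sum, hfq', mul_div_assoc]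
    simp only [h1, Finset.sum_const, Finset.card_univ, nsmul_eq_mul]
    simp only [mul_inv_cancel_left₀ hcard]
    rw [Finset.sum_comm, ← hq.2]
    refine Finset.sum_congr rfl fun x _ => ?_
    rw [← Finset.sum_mul, hfq, mul_div_assoc']
    exact mul_self_div_self _
  pX u v x := if x = e (u.2 + v.2) then 1 else 0
  pX_mem u v := ⟨fun x => by dsimp only; split_ifs <;> norm_num, by simp⟩

variable (e : G ≃ X) (f : ι → X → ℝ) (f' : κ → X → ℝ) (q : X → ℝ) (hf : ∀ i x, 0 ≤ f i x)
    (hf' : ∀ j x, 0 ≤ f' j x) (hq : q ∈ stdSimplex ℝ X) (hfq : ∀ x, ∑ i, f i x = q x)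
    (hfq' : ∀ x, ∑ j, f' j x = q x) (p : Channel X Y Z)

theorem padInput_isDeterministic :
    (padInput e f f' q hf hf' hq hfq hfq').IsDeterministic := by
  intro u v x
  simp only [padInput]
  split_ifs <;> simp

theorem AuxInput.law_UVX {U V : Type*} [Fintype U] [Fintype V] (r : AuxInput U V X)
    (u : U) (v : V) (x : X) :
    law (r.joint p) (fun ω => (rvU ω, rvV ω, rvX ω)) (u, v, x) = r.pUV (u, v) * r.pX u v x := by
  classical
  have h1 : ∀ x, ∑ y, ∑ z, p.prob x (y, z) = 1 := fun x => by
    rw [← Fintype.sum_prod_type]; exact (p.prob_mem x).2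
  have h2 : law (r.joint p) (fun ω => (rvU ω, rvV ω, rvX ω)) (u, v, x) =
      ∑ t : (U × V × X) × Y × Z, if t.1 = (u, v, x) then
        r.pUV (t.1.1, t.1.2.1) * r.pX t.1.1 t.1.2.1 t.1.2.2 * p.prob t.1.2.2 t.2 else 0 := by
    rw [← (jointEquiv (U := U) (V := V) (X := X) (Y := Y) (Z := Z)).sum_comp]
    exact Finset.sum_congr rfl fun ω _ => by congr
  rw [h2, Fintype.sum_prod_type, Finset.sum_eq_single (u, v, x)]
  · simp [Fintype.sum_prod_type, ← Finset.mul_sum, h1]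
  · intro t _ ht
    simp [ht]
  · simp

theorem AuxInput.law_UX {U V : Type*} [Fintype U] [Fintype V] (r : AuxInput U V X)
    (u : U) (x : X) :
    law (r.joint p) (fun ω => (rvU ω, rvX ω)) (u, x) = ∑ v, r.pUV (u, v) * r.pX u v x := by
  rw [← sum_law_prod_left (r.joint p) rvV]
  refine Finset.sum_congr rfl fun v _ => ?_
  rw [← r.law_UVX p]
  refine law_congr _ fun ω _ => ?_
  simp only [Prod.mk.injEq]; tauto

theorem AuxInput.law_VX {U V : Type*} [Fintype U] [Fintype V] (r : AuxInput U V X)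
    (v : V) (x : X) :
    law (r.joint p) (fun ω => (rvV ω, rvX ω)) (v, x) = ∑ u, r.pUV (u, v) * r.pX u v x := by
  rw [← sum_law_prod_left (r.joint p) rvU]
  simp only [← r.law_UVX p]

/-- Covers letters of zero mass, where `a ≤ b = 0` forces `a = 0`. -/
theorem mul_mul_div_of_le {a b c : ℝ} (ha : 0 ≤ a) (hab : a ≤ b) (hc : c = b) :
    a * c / b = a := by
  subst hc
  rcases eq_or_ne c 0 with h | h
  · subst h
    rw [le_antisymm hab ha]; simp
  · exact mul_div_cancel_right₀ a h

/-- The share is uniform and independent of `(I, X)`, so `U` tells no more about `X` than `I` does.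
-/
theorem padInput_law_UX (u : ι × G) (x : X) :
    law ((padInput e f f' q hf hf' hq hfq hfq').joint p) (fun ω => (rvU ω, rvX ω)) (u, x) =
      (Fintype.card G : ℝ)⁻¹ * f u.1 x := by
  classical
  rw [AuxInput.law_UX, Fintype.sum_prod_type, Finset.sum_comm]
  simp only [padInput]
  rw [sum_pad_left e u.2 fun x' => ∑ j, (Fintype.card G : ℝ)⁻¹ *
        (f u.1 x' * f' j x' / q x') * if x = x' then 1 else 0,
    Finset.sum_eq_single x (fun x' _ hne => by simp [hne.symm]) (by simp)]
  simp only [if_true, mul_one]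
  rw [← Finset.mul_sum, ← Finset.sum_div, ← Finset.mul_sum,
    mul_mul_div_of_le (hf _ _) ?_ (hfq' x)]
  rw [← hfq]
  exact Finset.single_le_sum (f := fun i => f i x) (fun i _ => hf i x) (Finset.mem_univ _)

theorem padInput_law_VX (v : κ × G) (x : X) :
    law ((padInput e f f' q hf hf' hq hfq hfq').joint p) (fun ω => (rvV ω, rvX ω)) (v, x) =
      (Fintype.card G : ℝ)⁻¹ * f' v.1 x := by
  classical
  rw [AuxInput.law_VX, Fintype.sum_prod_type, Finset.sum_comm]
  simp only [padInput]
  rw [sum_pad_right e v.2 fun x' => ∑ i, (Fintype.card G : ℝ)⁻¹ *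
        (f i x' * f' v.1 x' / q x') * if x = x' then 1 else 0,
    Finset.sum_eq_single x (fun x' _ hne => by simp [hne.symm]) (by simp)]
  simp only [if_true, mul_one]
  rw [← Finset.mul_sum, ← Finset.sum_div, ← Finset.sum_mul, mul_comm (∑ i, f i x),
    mul_mul_div_of_le (hf' _ _) ?_ (hfq x)]
  rw [← hfq']
  exact Finset.single_le_sum (f := fun i => f' i x) (fun i _ => hf' i x) (Finset.mem_univ _)

theorem padInput_law_X (x : X) :
    law ((padInput e f f' q hf hf' hq hfq hfq').joint p) rvX x = q x := by
  rw [← sum_law_prod_left _ rvU]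
  simp only [padInput_law_UX, Fintype.sum_prod_type]
  rw [Finset.sum_comm]
  simp [← Finset.mul_sum, hfq]

theorem sum_pad_const (w : ι → ℝ) : ∑ u : ι × G, (Fintype.card G : ℝ)⁻¹ * w u.1 = ∑ i, w i := by
  rw [Fintype.sum_prod_type, Finset.sum_comm]
  simp [← Finset.mul_sum]

end Pad

/-! ### Realizing hull points by deterministic auxiliary inputs -/

variable {X Y Z : Type*} [Fintype X] [Fintype Y] [Fintype Z]

/-- The index of a finite convex combination is the auxiliary variable: law `w`, conditional laws `r
i`. -/
theorem exists_fin_of_mem_entHull {W : X → Y → ℝ} {W' : X → Z → ℝ} {q : X → ℝ} {a b : ℝ}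
    (h : (q, a, b) ∈ entHull W W') :
    ∃ (k : ℕ) (w : Fin k → ℝ) (r : Fin k → X → ℝ), (∀ i, 0 ≤ w i) ∧
      (∀ i, r i ∈ stdSimplex ℝ X) ∧ (∀ x, ∑ i, w i * r i x = q x) ∧
      ∑ i, w i * outEnt W (r i) = a ∧ ∑ i, w i * outEnt W' (r i) = b := by
  obtain ⟨w, hw, z, hz, hsum⟩ := exists_sum_fin_of_mem_convexHull h
  choose r hr hrz using hz
  refine ⟨_, w, r, hw.1, hr, fun x => ?_, ?_, ?_⟩
  · have := congrFun (congrArg Prod.fst hsum) x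
    simpa [← hrz, Prod.fst_sum] using this
  · have := congrArg (fun t => t.2.1) hsum
    simpa [← hrz, Prod.fst_sum, Prod.snd_sum] using this
  · have := congrArg (fun t => t.2.2) hsum
    simpa [← hrz, Prod.snd_sum] using this

theorem hullRegion_subset_outerBoundXDet (p : Channel X Y Z) :
    hullRegion p ⊆ outerBoundXDet p := by
  rintro R ⟨q, a, b, a', b', h, h', hR⟩
  have hq : q ∈ stdSimplex ℝ X := entHull_fst_mem h
  have hne : Nonempty X := by
    by_contra hX
    rw [not_nonempty_iff] at hX
    simpa using hq.2
  have : NeZero (Fintype.card X) := ⟨Fintype.card_ne_zero⟩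
  -- Any group of the right order would do; `ZMod` also keeps the auxiliary alphabets in `Type`,
  -- whatever the universe of `X`.
  have e : ZMod (Fintype.card X) ≃ X := Fintype.equivOfCardEq (ZMod.card _)
  obtain ⟨k, w, r, hw, hr, hwq, ha, hb⟩ := exists_fin_of_mem_entHull h
  obtain ⟨l, w', r', hw', hr', hwq', ha', hb'⟩ := exists_fin_of_mem_entHull h'
  set t := padInput e (fun i x => w i * r i x) (fun j x => w' j * r' j x) q
    (fun i x => mul_nonneg (hw i) ((hr i).1 x)) (fun j x => mul_nonneg (hw' j) ((hr' j).1 x))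
    hq hwq hwq' with ht
  refine ⟨_, _, _, _, t, padInput_isDeterministic _ _ _ _ _ _ _ _ _, ?_⟩
  have hX : law (t.joint p) rvX = q := funext fun x => padInput_law_X ..
  have hUX : ∀ u x, law (t.joint p) (fun ω => (rvU ω, rvX ω)) (u, x) =
      ((Fintype.card (ZMod (Fintype.card X)) : ℝ)⁻¹ * w u.1) * r u.1 x := fun u x => by
    rw [ht, padInput_law_UX]; ring
  have hVX : ∀ v x, law (t.joint p) (fun ω => (rvV ω, rvX ω)) (v, x) =
      ((Fintype.card (ZMod (Fintype.card X)) : ℝ)⁻¹ * w' v.1) * r' v.1 x := fun v x => by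
    rw [ht, padInput_law_VX]; ring
  have e1 := (t.isMarkov_Y p Prod.fst).ent_pair_sub p.toY_mem (fun u => hr u.1) hUX
  have e2 := (t.isMarkov_Z p Prod.fst).ent_pair_sub p.toZ_mem (fun u => hr u.1) hUX
  have e3 := (t.isMarkov_Y p Prod.snd).ent_pair_sub p.toY_mem (fun v => hr' v.1) hVX
  have e4 := (t.isMarkov_Z p Prod.snd).ent_pair_sub p.toZ_mem (fun v => hr' v.1) hVX
  simp only [mul_assoc] at e1 e2 e3 e4
  rw [sum_pad_const fun i => w i * outEnt p.toY (r i), ha] at e1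
  rw [sum_pad_const fun i => w i * outEnt p.toZ (r i), hb] at e2
  rw [sum_pad_const fun i => w' i * outEnt p.toY (r' i), hb'] at e3
  rw [sum_pad_const fun i => w' i * outEnt p.toZ (r' i), ha'] at e4
  rw [t.mem_regionX_iff, hX]
  change ent (t.joint p) (fun ω => (rvU ω, rvY ω)) - ent (t.joint p) rvU = _ at e1
  change ent (t.joint p) (fun ω => (rvU ω, rvZ ω)) - ent (t.joint p) rvU = _ at e2
  change ent (t.joint p) (fun ω => (rvV ω, rvY ω)) - ent (t.joint p) rvV = _ at e3
  change ent (t.joint p) (fun ω => (rvV ω, rvZ ω)) - ent (t.joint p) rvV = _ at e4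
  rw [e1, e2, e3, e4]
  exact hR

/-! ### Block inequalities -/

section Block

variable {Ω μ X Y Z : Type*} [Fintype Ω] {P : Ω → ℝ} {n : ℕ}

/-- The message, the past of `y` and the future of `z`. -/
def auxVar (M : Ω → μ) (y : Ω → Fin n → Y) (z : Ω → Fin n → Z) (i : Fin n) (ω : Ω) :
    μ × (Fin n → Option (Y ⊕ Z)) :=
  (M ω, fun j => if j < i then some (.inl (y ω j)) else if i < j then some (.inr (z ω j)) else none)

/-- `H(M, Y^n) - H(M)` is at least the sum of the `H(Y_i | U_i)`. -/
theorem sum_ent_auxVar_le [Fintype μ] [Fintype Y] [Fintype Z] (hP : ∀ ω, 0 ≤ P ω)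
    (M : Ω → μ) (y : Ω → Fin n → Y) (z : Ω → Fin n → Z) :
    ∑ i, (ent P (fun ω => (auxVar M y z i ω, y ω i)) - ent P (auxVar M y z i)) ≤
      ent P (fun ω => (M ω, y ω)) - ent P M := by
  -- Chain rule for the first `k` letters of `y`, the others being masked by `none`.
  let S : ℕ → ℝ := fun k => ent P fun ω => (M ω, fun j : Fin n => if (j : ℕ) < k then some (y ω j)
    else none)
  have h0 : S 0 = ent P M := ent_congr fun _ _ _ _ => by simp
  have hn : S n = ent P (fun ω => (M ω, y ω)) := ent_congr fun _ _ _ _ => by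
    simp [funext_iff]
  rw [← h0, ← hn, ← Finset.sum_range_sub S n, ← Fin.sum_univ_eq_sum_range (fun k => S (k + 1) - S k)]
  refine Finset.sum_le_sum fun i _ => ?_
  -- Forgetting the future of `z` can only increase the conditional entropy of `y ω i`.
  let c : μ × (Fin n → Option (Y ⊕ Z)) → μ × (Fin n → Option Y) := fun u =>
    (u.1, fun j => (u.2 j).bind (Sum.elim some fun _ => none))
  have h := ent_sub_le_of_comp hP (fun ω => y ω i) (auxVar M y z i) c
  have hc : ∀ ω, c (auxVar M y z i ω) =
      (M ω, fun j : Fin n => if (j : ℕ) < i then some (y ω j) else none) := fun ω => by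
    simp only [c, auxVar, Prod.mk.injEq, true_and]
    funext j
    by_cases h1 : j < i
    · simp [h1]
    · by_cases h2 : i < j <;> simp [h1, h2]
  simp only [hc] at h
  refine h.trans (le_of_eq ?_)
  congr 1
  refine ent_congr fun ω ω' _ _ => ?_
  simp only [Prod.mk.injEq, funext_iff]
  constructor
  · rintro ⟨⟨h1, h2⟩, h3⟩
    refine ⟨h1, fun j => ?_⟩
    rcases lt_trichotomy (j : ℕ) i with hj | hj | hj
    · have := h2 j
      rw [if_pos hj, if_pos hj] at this
      rw [this]
    · rw [Fin.ext hj, h3]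
    · simp [show ¬ (j : ℕ) < i + 1 by omega]
  · rintro ⟨h1, h2⟩
    refine ⟨⟨h1, fun j => ?_⟩, ?_⟩
    · have := h2 j
      by_cases hj : (j : ℕ) < i
      · simpa [show (j : ℕ) < i + 1 by omega, hj] using this
      · simp [hj]
    · simpa using h2 i

/-- The Csiszár sum identity, as a telescoping sum. -/
theorem sum_ent_auxVar_sub (M : Ω → μ) (y : Ω → Fin n → Y) (z : Ω → Fin n → Z) :
    ∑ i, (ent P (fun ω => (auxVar M y z i ω, z ω i)) - ent P (fun ω => (auxVar M y z i ω, y ω i))) =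
      ent P (fun ω => (M ω, z ω)) - ent P (fun ω => (M ω, y ω)) := by
  -- Hybrid block: `y` before position `k`, `z` from `k` on. Adjoining `z ω i` to `auxVar` gives `T
  -- i`, adjoining `y ω i` gives `T (i + 1)`.
  let T : ℕ → ℝ := fun k => ent P fun ω => (M ω, fun j : Fin n =>
    if (j : ℕ) < k then (.inl (y ω j) : Y ⊕ Z) else .inr (z ω j))
  have h0 : T 0 = ent P (fun ω => (M ω, z ω)) := ent_congr fun _ _ _ _ => by simp [funext_iff]
  have hn : T n = ent P (fun ω => (M ω, y ω)) := ent_congr fun _ _ _ _ => by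
    simp [funext_iff]
  rw [← h0, ← hn, ← Finset.sum_range_sub' T n,
    ← Fin.sum_univ_eq_sum_range (fun k => T k - T (k + 1))]
  refine Finset.sum_congr rfl fun i _ => ?_
  congr 1
  · refine ent_congr fun ω ω' _ _ => ?_
    simp only [auxVar, Prod.mk.injEq, funext_iff]
    constructor
    · rintro ⟨⟨h1, h2⟩, h3⟩
      refine ⟨h1, fun j => ?_⟩
      have := h2 j
      rcases lt_trichotomy j i with hj | hj | hj
      · simpa [hj, Fin.lt_def.1 hj] using this
      · subst hj; simpa using h3
      · simpa [hj, not_lt.2 hj.le] using this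
    · rintro ⟨h1, h2⟩
      refine ⟨⟨h1, fun j => ?_⟩, by simpa using h2 i⟩
      have := h2 j
      rcases lt_trichotomy j i with hj | hj | hj
      · simpa [hj, Fin.lt_def.1 hj] using this
      · subst hj; simp
      · simpa [hj, not_lt.2 hj.le] using this
  · refine ent_congr fun ω ω' _ _ => ?_
    simp only [auxVar, Prod.mk.injEq, funext_iff]
    constructor
    · rintro ⟨⟨h1, h2⟩, h3⟩
      refine ⟨h1, fun j => ?_⟩
      have := h2 j
      rcases lt_trichotomy j i with hj | hj | hj
      · simpa [hj, Nat.lt_succ_of_lt (Fin.lt_def.1 hj)] using this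
      · subst hj; simpa using h3
      · simpa [hj, not_lt.2 hj.le, show ¬ (j : ℕ) < i + 1 from not_lt.2 (Nat.succ_le_of_lt hj)]
          using this
    · rintro ⟨h1, h2⟩
      refine ⟨⟨h1, fun j => ?_⟩, by simpa using h2 i⟩
      have := h2 j
      rcases lt_trichotomy j i with hj | hj | hj
      · simpa [hj, Nat.lt_succ_of_lt (Fin.lt_def.1 hj)] using this
      · subst hj; simp
      · simpa [hj, not_lt.2 hj.le, show ¬ (j : ℕ) < i + 1 from not_lt.2 (Nat.succ_le_of_lt hj)]
          using this

theorem IsMarkov.noiseEnt_le {α : Type*} [Fintype α] [Fintype X] [Fintype Y]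
    (hP : ∀ ω, 0 ≤ P ω) {U : Ω → α} {ξ : Ω → X} {η : Ω → Y} {W : X → Y → ℝ}
    (h : IsMarkov P U ξ η W) (hW : ∀ x, W x ∈ stdSimplex ℝ Y) :
    noiseEnt W (law P ξ) ≤ ent P (fun ω => (U ω, η ω)) - ent P U := by
  rw [← h.ent_triple_sub hW]
  have h1 := ent_sub_le_of_comp hP η (fun ω => (U ω, ξ ω)) Prod.fst
  rwa [ent_congr (f := fun ω => ((U ω, ξ ω), η ω)) (g := fun ω => (U ω, ξ ω, η ω))
    (fun _ _ _ _ => by simp only [Prod.mk.injEq]; tauto)] at h1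

/-- The average law of the input letters. -/
def avgLaw (P : Ω → ℝ) (ξ : Fin n → Ω → X) (x : X) : ℝ := (n : ℝ)⁻¹ * ∑ i, law P (ξ i) x

theorem nsmul_avgLaw (hn : n ≠ 0) (ξ : Fin n → Ω → X) (x : X) :
    n * avgLaw P ξ x = ∑ i, law P (ξ i) x :=
  mul_inv_cancel_left₀ (Nat.cast_ne_zero.2 hn) _

theorem sum_noiseEnt [Fintype X] [Fintype Y] (hn : n ≠ 0) (ξ : Fin n → Ω → X) (W : X → Y → ℝ) :
    ∑ i, noiseEnt W (law P (ξ i)) = n * noiseEnt W (avgLaw P ξ) := by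
  unfold noiseEnt
  rw [Finset.sum_comm, Finset.mul_sum]
  refine Finset.sum_congr rfl fun x _ => ?_
  rw [← Finset.sum_mul, ← mul_assoc, nsmul_avgLaw hn]

/-- Gibbs' inequality against the `n`-fold product of the average output law yields subadditivity
and concavity in one stroke. -/
theorem ent_block_le [Fintype X] [Fintype Y] (hP : P ∈ stdSimplex ℝ Ω) (hn : n ≠ 0)
    (ξ : Fin n → Ω → X) (y : Ω → Fin n → Y) (W : X → Y → ℝ)
    (hy : ∀ i b, law P (fun ω => y ω i) b = ∑ x, law P (ξ i) x * W x b) :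
    ent P y ≤ n * outEnt W (avgLaw P ξ) := by
  classical
  have hn' : (0 : ℝ) < n := by positivity
  set r : Y → ℝ := fun b => ∑ x, avgLaw P ξ x * W x b with hr
  have hnr : ∀ b, n * r b = ∑ i, law P (fun ω => y ω i) b := fun b => by
    simp only [hy, hr]
    rw [Finset.sum_comm, Finset.mul_sum]
    refine Finset.sum_congr rfl fun x _ => ?_
    rw [← Finset.sum_mul, ← mul_assoc, nsmul_avgLaw hn]
  have hr0 : ∀ b, 0 ≤ r b := fun b => by
    refine nonneg_of_mul_nonneg_right (b := r b) (a := (n : ℝ)) ?_ hn'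
    rw [hnr]
    exact Finset.sum_nonneg fun i _ => law_nonneg hP.1 _ _
  have hr1 : ∑ b, r b = 1 := by
    refine mul_left_cancel₀ hn'.ne' ?_
    rw [Finset.mul_sum]
    simp only [hnr]
    rw [Finset.sum_comm]
    simp [sum_law, hP.2]
  have hrpos : ∀ ω, P ω ≠ 0 → ∀ i, 0 < r (y ω i) := fun ω h0 i => by
    refine pos_of_mul_pos_right (b := r (y ω i)) (a := (n : ℝ)) ?_ hn'.le
    rw [hnr]
    exact (law_pos hP.1 (fun ω => y ω i) h0).trans_le <|
      Finset.single_le_sum (f := fun j => law P (fun ω => y ω j) (y ω i))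
        (fun j _ => law_nonneg hP.1 _ _) (Finset.mem_univ i)
  refine (ent_le_of_sum_le hP.1 y (fun v => ∏ i, r (v i))
    (fun v => Finset.prod_nonneg fun i _ => hr0 _)
    (fun ω h0 => Finset.prod_pos fun i _ => hrpos ω h0 i) ?_).trans (le_of_eq ?_)
  · have := Finset.prod_univ_sum (fun _ : Fin n => (Finset.univ : Finset Y)) fun _ b => r b
    rw [Fintype.piFinset_univ] at this
    rw [← this, hP.2]
    simp [hr1]
  · have h1 : ∑ ω, P ω * Real.log (∏ i, r (y ω i)) = ∑ ω, ∑ i, P ω * Real.log (r (y ω i)) := by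
      refine Finset.sum_congr rfl fun ω _ => ?_
      by_cases h0 : P ω = 0
      · simp [h0]
      rw [Real.log_prod fun i _ => (hrpos ω h0 i).ne', Finset.mul_sum]
    rw [h1, Finset.sum_comm]
    have h2 : ∀ i, ∑ ω, P ω * Real.log (r (y ω i)) =
        ∑ b, law P (fun ω => y ω i) b * Real.log (r b) := fun i =>
      (sum_law_mul P (fun ω => y ω i) fun b => Real.log (r b)).symm
    simp only [h2]
    rw [Finset.sum_comm]
    simp only [← Finset.sum_mul, ← hnr]
    rw [outEnt, Finset.mul_sum, ← Finset.sum_neg_distrib]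
    refine Finset.sum_congr rfl fun b _ => ?_
    simp only [Real.negMulLog, hr]
    ring

/-- The average of the single-letter entropies of `auxVar` lies in the hull. -/
theorem exists_mem_entHull_avgLaw [Fintype μ] [Fintype X] [Fintype Y] [Fintype Z]
    (hP : P ∈ stdSimplex ℝ Ω) (hn : n ≠ 0)
    (M : Ω → μ) (ξ : Fin n → Ω → X) (y : Ω → Fin n → Y) (z : Ω → Fin n → Z)
    {W : X → Y → ℝ} {W' : X → Z → ℝ} (hW : ∀ x, W x ∈ stdSimplex ℝ Y)
    (hW' : ∀ x, W' x ∈ stdSimplex ℝ Z)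
    (hy : ∀ i, IsMarkov P (auxVar M y z i) (ξ i) (fun ω => y ω i) W)
    (hz : ∀ i, IsMarkov P (auxVar M y z i) (ξ i) (fun ω => z ω i) W') :
    ∃ a b, (avgLaw P ξ, a, b) ∈ entHull W W' ∧
      n * a ≤ ent P (fun ω => (M ω, y ω)) - ent P M ∧
      n * b - n * a = ent P (fun ω => (M ω, z ω)) - ent P (fun ω => (M ω, y ω)) := by
  have hn' : (n : ℝ) ≠ 0 := Nat.cast_ne_zero.2 hn
  have h := (convex_convexHull ℝ ((fun q => (q, outEnt W q, outEnt W' q)) '' stdSimplex ℝ X)).sum_mem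
    (t := Finset.univ) (w := fun _ : Fin n => (n : ℝ)⁻¹) (fun _ _ => by positivity)
    (by simp [hn']) (fun i _ => (hy i).mem_entHull hP (hz i) hW hW')
  refine ⟨(n : ℝ)⁻¹ * ∑ i, (ent P (fun ω => (auxVar M y z i ω, y ω i)) - ent P (auxVar M y z i)),
    (n : ℝ)⁻¹ * ∑ i, (ent P (fun ω => (auxVar M y z i ω, z ω i)) - ent P (auxVar M y z i)),
    ?_, ?_, ?_⟩
  · unfold entHull
    convert h using 1
    refine Prod.ext ?_ (Prod.ext ?_ ?_)
    · ext x
      simp [avgLaw, Prod.fst_sum, Finset.mul_sum]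
    · simp only [Finset.mul_sum, Prod.fst_sum, Prod.snd_sum, Prod.smul_mk, smul_eq_mul]
    · simp only [Finset.mul_sum, Prod.snd_sum, Prod.smul_mk, smul_eq_mul]
  · rw [mul_inv_cancel_left₀ hn']
    exact sum_ent_auxVar_le hP.1 M y z
  · rw [mul_inv_cancel_left₀ hn', mul_inv_cancel_left₀ hn', ← Finset.sum_sub_distrib,
      ← sum_ent_auxVar_sub M y z]
    exact Finset.sum_congr rfl fun i _ => by ring

open Classical in
/-- Fano's inequality. -/
theorem ent_pair_sub_le_fano {β : Type*} [Fintype μ] [Fintype β] (hP : P ∈ stdSimplex ℝ Ω)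
    (M : Ω → μ) (y : Ω → β) (dec : β → μ) :
    ent P (fun ω => (M ω, y ω)) - ent P y ≤
      Real.log 2 + (∑ ω, if dec (y ω) ≠ M ω then P ω else 0) * Real.log (Fintype.card μ) := by
  rcases isEmpty_or_nonempty μ with hμ | hμ
  · have : IsEmpty Ω := M.isEmpty
    simpa using hP.2
  have hN : (1 : ℝ) ≤ Fintype.card μ := by exact_mod_cast Fintype.card_pos
  set N : ℝ := (Fintype.card μ : ℝ) with hNdef
  -- Guess for `M` given `y`: half the mass on the decoded value, half spread uniformly. A correct
  -- decoding costs at most `log 2`, a wrong one exactly `log 2 + log N`.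
  let g : μ → β → ℝ := fun m b => (if dec b = m then 1 / 2 else 0) + 1 / (2 * N)
  have hg : ∀ m b, 0 < g m b := fun m b => by
    have : 0 < 1 / (2 * N) := by positivity
    simp only [g]
    split_ifs <;> linarith
  have h := ent_le_of_sum_le hP.1 (fun ω => (M ω, y ω)) (fun t => g t.1 t.2 * law P y t.2)
    (fun t => mul_nonneg (hg _ _).le (law_nonneg hP.1 _ _))
    (fun ω h0 => mul_pos (hg _ _) (law_pos hP.1 y h0)) ?_
  · have h1 : ∑ ω, P ω * Real.log (g (M ω) (y ω) * law P y (y ω)) =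
        ∑ ω, P ω * Real.log (g (M ω) (y ω)) - ent P y := by
      rw [ent, sub_neg_eq_add, ← Finset.sum_add_distrib]
      refine Finset.sum_congr rfl fun ω _ => ?_
      by_cases h0 : P ω = 0
      · simp [h0]
      rw [Real.log_mul (hg _ _).ne' (law_pos hP.1 y h0).ne', mul_add]
    have h2 : ∑ ω, P ω * -Real.log (g (M ω) (y ω)) ≤
        ∑ ω, (P ω * Real.log 2 + (if dec (y ω) ≠ M ω then P ω else 0) * Real.log N) := by
      refine Finset.sum_le_sum fun ω _ => ?_
      by_cases hd : dec (y ω) = M ω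
      · simp only [hd, ne_eq, not_true, if_false, zero_mul, add_zero]
        refine mul_le_mul_of_nonneg_left ?_ (hP.1 ω)
        rw [← Real.log_inv]
        refine Real.log_le_log (inv_pos.2 (hg _ _)) ?_
        refine inv_le_of_inv_le₀ two_pos ?_
        have : 0 < 1 / (2 * N) := by positivity
        simp only [g, hd, if_true]
        linarith
      · simp only [hd, ne_eq, not_false_eq_true, if_true, ← mul_add]
        refine mul_le_mul_of_nonneg_left (le_of_eq ?_) (hP.1 ω)
        simp only [g, hd, if_false, zero_add]
        rw [one_div, Real.log_inv, neg_neg, Real.log_mul two_ne_zero (by positivity)]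
    rw [Finset.sum_add_distrib, ← Finset.sum_mul, ← Finset.sum_mul, hP.2, one_mul] at h2
    simp only [mul_neg, Finset.sum_neg_distrib] at h2
    simp only [h1] at h
    linarith
  · rw [Fintype.sum_prod_type, Finset.sum_comm]
    simp only [← Finset.sum_mul]
    have h1 : ∀ b, ∑ m, g m b = 1 := fun b => by
      simp only [g, Finset.sum_add_distrib, Finset.sum_ite_eq, Finset.mem_univ, if_true,
        Finset.sum_const, Finset.card_univ, nsmul_eq_mul, ← hNdef]
      field_simp
      norm_num
    simp only [h1, one_mul, sum_law]
    exact le_rfl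

theorem ent_of_uniform [Fintype μ] [Nonempty μ] (M : Ω → μ)
    (h : ∀ m, law P M m = (Fintype.card μ : ℝ)⁻¹) : ent P M = Real.log (Fintype.card μ) := by
  rw [ent_eq_sum_negMulLog]
  simp [h, Real.negMulLog]

end Block

/-! ### The converse -/

section CodeSpace

variable {X Y Z M₀ M₁ M₂ : Type*} [Fintype Y] [Fintype Z] [Fintype M₁] [Fintype M₂] {n : ℕ}

/-- The joint law of the private messages and the outputs, for the common message `m₀`. -/
def Code.joint (c : Code X Y Z M₀ M₁ M₂ n) (p : Channel X Y Z) (m₀ : M₀)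
    (ω : (M₁ × M₂) × (Fin n → Y × Z)) : ℝ :=
  ((Fintype.card M₁ : ℝ) * Fintype.card M₂)⁻¹ * ∏ i, p.prob (c.enc m₀ ω.1.1 ω.1.2 i) (ω.2 i)

variable (c : Code X Y Z M₀ M₁ M₂ n) (p : Channel X Y Z) (m₀ : M₀)

theorem sum_prod_prob (x : Fin n → X) : ∑ w : Fin n → Y × Z, ∏ i, p.prob (x i) (w i) = 1 := by
  classical
  have := Finset.prod_univ_sum (fun _ : Fin n => (Finset.univ : Finset (Y × Z)))
    fun i b => p.prob (x i) b
  rw [Fintype.piFinset_univ] at this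
  rw [← this]
  simp [(p.prob_mem _).2]

theorem Code.joint_nonneg (ω : (M₁ × M₂) × (Fin n → Y × Z)) : 0 ≤ c.joint p m₀ ω :=
  mul_nonneg (by positivity) (Finset.prod_nonneg fun _ _ => (p.prob_mem _).1 _)

theorem Code.law_messages (m : M₁ × M₂) :
    law (c.joint p m₀) Prod.fst m = ((Fintype.card M₁ : ℝ) * Fintype.card M₂)⁻¹ := by
  classical
  unfold law
  rw [Fintype.sum_prod_type, Finset.sum_eq_single m (fun m' _ h => by simp [h]) (by simp)]
  simp only [if_true, joint, ← Finset.mul_sum, sum_prod_prob, mul_one]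

theorem Code.joint_mem [Nonempty M₁] [Nonempty M₂] :
    c.joint p m₀ ∈ stdSimplex ℝ ((M₁ × M₂) × (Fin n → Y × Z)) := by
  refine ⟨c.joint_nonneg p m₀, ?_⟩
  rw [← sum_law (c.joint p m₀) Prod.fst]
  simp only [c.law_messages, Finset.sum_const, Finset.card_univ, nsmul_eq_mul, Fintype.card_prod,
    Nat.cast_mul]
  exact mul_inv_cancel₀ (by simp)

theorem Code.ent_messages [Nonempty M₁] [Nonempty M₂] :
    ent (c.joint p m₀) Prod.fst = Real.log (Fintype.card M₁) + Real.log (Fintype.card M₂) := by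
  rw [ent_of_uniform _ fun m => by rw [c.law_messages, Fintype.card_prod, Nat.cast_mul],
    Fintype.card_prod, Nat.cast_mul, Real.log_mul (by simp) (by simp)]

theorem Code.ent_message₁ [Nonempty M₁] [Nonempty M₂] :
    ent (c.joint p m₀) (fun ω => ω.1.1) = Real.log (Fintype.card M₁) := by
  refine ent_of_uniform _ fun m => ?_
  rw [← sum_law_prod_right _ _ (fun ω => ω.1.2)]
  have : ∀ m', law (c.joint p m₀) (fun ω => (ω.1.1, ω.1.2)) (m, m') = _ :=
    fun m' => c.law_messages p m₀ (m, m')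
  simp [this]

theorem Code.ent_message₂ [Nonempty M₁] [Nonempty M₂] :
    ent (c.joint p m₀) (fun ω => ω.1.2) = Real.log (Fintype.card M₂) := by
  refine ent_of_uniform _ fun m => ?_
  rw [← sum_law_prod_left _ (fun ω => ω.1.1)]
  have : ∀ m', law (c.joint p m₀) (fun ω => (ω.1.1, ω.1.2)) (m', m) = _ :=
    fun m' => c.law_messages p m₀ (m', m)
  simp only [this, Finset.sum_const, Finset.card_univ, nsmul_eq_mul]
  have h : (Fintype.card M₁ : ℝ) ≠ 0 := by simp
  rw [mul_inv, mul_inv_cancel_left₀ h]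

/-- Separates the channel use `i`. -/
def splitEquiv (M : Type*) (B : Type*) (i : Fin n) :
    M × (Fin n → B) ≃ (M × ({j // j ≠ i} → B)) × B :=
  ((Equiv.refl M).prodCongr ((Equiv.funSplitAt i B).trans (Equiv.prodComm _ _))).trans
    (Equiv.prodAssoc _ _ _).symm

/-- Memorylessness: channel use `i` splits off as a factor, in the form that `isMarkov_toY`
requires. -/
theorem Code.joint_eq_split (i : Fin n) (ω : (M₁ × M₂) × (Fin n → Y × Z)) :
    c.joint p m₀ ω = (((Fintype.card M₁ : ℝ) * Fintype.card M₂)⁻¹ *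
      ∏ j : {j // j ≠ i}, p.prob (c.enc m₀ (splitEquiv _ _ i ω).1.1.1 (splitEquiv _ _ i ω).1.1.2 j)
        ((splitEquiv _ _ i ω).1.2 j)) *
      p.prob (c.enc m₀ (splitEquiv _ _ i ω).1.1.1 (splitEquiv _ _ i ω).1.1.2 i)
        (splitEquiv _ _ i ω).2 := by
  have h := Finset.prod_subtype (F := inferInstance) (p := fun j => j ≠ i) (Finset.univ.erase i) (by simp)
    fun j => p.prob (c.enc m₀ ω.1.1 ω.1.2 j) (ω.2 j)
  rw [joint, ← Finset.mul_prod_erase Finset.univ _ (Finset.mem_univ i), h]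
  simp only [splitEquiv, Equiv.funSplitAt, Equiv.piSplitAt, Equiv.trans_apply,
    Equiv.prodCongr_apply, Prod.map, Equiv.refl_apply, Equiv.prodComm_apply, Prod.swap,
    Equiv.prodAssoc_symm_apply, Equiv.coe_fn_mk]
  ring

theorem Code.isMarkov_toY {α : Type*} (i : Fin n)
    (h : (M₁ × M₂) × ({j // j ≠ i} → Y × Z) → α) :
    IsMarkov (c.joint p m₀) (fun ω => h (splitEquiv _ _ i ω).1) (fun ω => c.enc m₀ ω.1.1 ω.1.2 i)
      (fun ω => (ω.2 i).1) p.toY :=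
  BCOuter.isMarkov_toY p (splitEquiv _ _ i)
    (fun γ => ((Fintype.card M₁ : ℝ) * Fintype.card M₂)⁻¹ *
      ∏ j : {j // j ≠ i}, p.prob (c.enc m₀ γ.1.1 γ.1.2 j) (γ.2 j)) (fun γ => c.enc m₀ γ.1.1 γ.1.2 i)
    (c.joint_eq_split p m₀ i) h

theorem Code.isMarkov_toZ {α : Type*} (i : Fin n)
    (h : (M₁ × M₂) × ({j // j ≠ i} → Y × Z) → α) :
    IsMarkov (c.joint p m₀) (fun ω => h (splitEquiv _ _ i ω).1) (fun ω => c.enc m₀ ω.1.1 ω.1.2 i)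
      (fun ω => (ω.2 i).2) p.toZ :=
  BCOuter.isMarkov_toZ p (splitEquiv _ _ i)
    (fun γ => ((Fintype.card M₁ : ℝ) * Fintype.card M₂)⁻¹ *
      ∏ j : {j // j ≠ i}, p.prob (c.enc m₀ γ.1.1 γ.1.2 j) (γ.2 j)) (fun γ => c.enc m₀ γ.1.1 γ.1.2 i)
    (c.joint_eq_split p m₀ i) h

/-- `auxVar` at `i` ignores the outputs of channel use `i`, so it is a function of what remains
after splitting that use off. -/
theorem auxVar_eq_split {M μ B Y' Z' : Type*} (g : M → μ) (f : B → Y') (f' : B → Z') (i : Fin n) :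
    (auxVar (fun ω : M × (Fin n → B) => g ω.1) (fun ω j => f (ω.2 j)) (fun ω j => f' (ω.2 j)) i) =
      fun ω => (fun γ : M × ({j // j ≠ i} → B) => (g γ.1, fun j : Fin n =>
        if hj : j = i then none else
          if j < i then some (Sum.inl (f (γ.2 ⟨j, hj⟩))) else some (Sum.inr (f' (γ.2 ⟨j, hj⟩)))))
        (splitEquiv M B i ω).1 := by
  funext ω
  refine Prod.ext rfl (funext fun j => ?_)
  rcases lt_trichotomy j i with h | h | h
  · simp [auxVar, h, h.ne, splitEquiv]
  · simp [auxVar, h]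
  · simp [auxVar, h, h.ne', not_lt.2 h.le, splitEquiv]

/-- With `f` and `f'` free, either output may play the past and the other the future. -/
theorem Code.isMarkov_auxVar_toY {μ Y' Z' : Type*} (g : M₁ × M₂ → μ) (f : Y × Z → Y')
    (f' : Y × Z → Z') (i : Fin n) :
    IsMarkov (c.joint p m₀)
      (auxVar (fun ω => g ω.1) (fun ω j => f (ω.2 j)) (fun ω j => f' (ω.2 j)) i)
      (fun ω => c.enc m₀ ω.1.1 ω.1.2 i) (fun ω => (ω.2 i).1) p.toY := by
  rw [auxVar_eq_split g f f']
  exact c.isMarkov_toY p m₀ i (fun γ => (g γ.1, fun j : Fin n =>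
    if hj : j = i then none else
      if j < i then some (Sum.inl (f (γ.2 ⟨j, hj⟩))) else some (Sum.inr (f' (γ.2 ⟨j, hj⟩)))))

theorem Code.isMarkov_auxVar_toZ {μ Y' Z' : Type*} (g : M₁ × M₂ → μ) (f : Y × Z → Y')
    (f' : Y × Z → Z') (i : Fin n) :
    IsMarkov (c.joint p m₀)
      (auxVar (fun ω => g ω.1) (fun ω j => f (ω.2 j)) (fun ω j => f' (ω.2 j)) i)
      (fun ω => c.enc m₀ ω.1.1 ω.1.2 i) (fun ω => (ω.2 i).2) p.toZ := by
  rw [auxVar_eq_split g f f']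
  exact c.isMarkov_toZ p m₀ i (fun γ => (g γ.1, fun j : Fin n =>
    if hj : j = i then none else
      if j < i then some (Sum.inl (f (γ.2 ⟨j, hj⟩))) else some (Sum.inr (f' (γ.2 ⟨j, hj⟩)))))

open Classical in
theorem Code.errorProb_eq [Fintype M₀] (h₀ : Fintype.card M₀ = 1) :
    c.errorProb p = ∑ ω, if c.decY (fun i => (ω.2 i).1) ≠ (m₀, ω.1.1) ∨
      c.decZ (fun i => (ω.2 i).2) ≠ (m₀, ω.1.2) then c.joint p m₀ ω else 0 := by
  obtain ⟨a, ha⟩ := Fintype.card_eq_one_iff.1 h₀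
  have huniv : (Finset.univ : Finset M₀) = {m₀} := by
    ext m; simp [ha m, ha m₀]
  unfold errorProb joint
  rw [huniv, Finset.sum_singleton, h₀, Nat.cast_one, one_mul, div_eq_inv_mul, Finset.mul_sum]
  simp only [Fintype.sum_prod_type, Finset.mul_sum]
  refine Finset.sum_congr rfl fun m₁ _ => Finset.sum_congr rfl fun m₂ _ => ?_
  simp only [← Finset.mul_sum]
  rw [← Fintype.sum_prod_type', Finset.mul_sum,
    ← (Equiv.arrowProdEquivProdArrow (Fin n) (fun _ => Y) fun _ => Z).sum_comp]
  refine Finset.sum_congr rfl fun w _ => ?_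
  rw [mul_ite, mul_zero]
  rfl

/-- Fano's inequality; an error on the first receiver's private message is contained in the overall
error event. -/
theorem Code.ent_message₁_le [Nonempty M₁] [Nonempty M₂] [Fintype M₀] (h₀ : Fintype.card M₀ = 1) :
    ent (c.joint p m₀) (fun ω => (ω.1.1, fun i => (ω.2 i).1)) -
      ent (c.joint p m₀) (fun ω i => (ω.2 i).1) ≤
    Real.log 2 + c.errorProb p * Real.log (Fintype.card M₁) := by
  classical
  refine (ent_pair_sub_le_fano (c.joint_mem p m₀) (fun ω => ω.1.1) (fun ω i => (ω.2 i).1)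
    fun y => (c.decY y).2).trans ?_
  rw [c.errorProb_eq p m₀ h₀]
  gcongr with ω
  by_cases h : (c.decY fun i => (ω.2 i).1).2 = ω.1.1
  · simp only [h, ne_eq, not_true, if_false]
    split_ifs <;> simp [c.joint_nonneg]
  · have : (c.decY fun i => (ω.2 i).1) ≠ (m₀, ω.1.1) := fun h' => h (by rw [h'])
    simp [h, this]

theorem Code.ent_message₂_le [Nonempty M₁] [Nonempty M₂] [Fintype M₀] (h₀ : Fintype.card M₀ = 1) :
    ent (c.joint p m₀) (fun ω => (ω.1.2, fun i => (ω.2 i).2)) -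
      ent (c.joint p m₀) (fun ω i => (ω.2 i).2) ≤
    Real.log 2 + c.errorProb p * Real.log (Fintype.card M₂) := by
  classical
  refine (ent_pair_sub_le_fano (c.joint_mem p m₀) (fun ω => ω.1.2) (fun ω i => (ω.2 i).2)
    fun z => (c.decZ z).2).trans ?_
  rw [c.errorProb_eq p m₀ h₀]
  gcongr with ω
  by_cases h : (c.decZ fun i => (ω.2 i).2).2 = ω.1.2
  · simp only [h, ne_eq, not_true, if_false]
    split_ifs <;> simp [c.joint_nonneg]
  · have : (c.decZ fun i => (ω.2 i).2) ≠ (m₀, ω.1.2) := fun h' => h (by rw [h'])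
    simp [h, this]

variable [Fintype X]

/-- The single-letter bounds satisfied by a code. -/
theorem Code.mem_hullRegion [Nonempty M₁] [Nonempty M₂] [Fintype M₀] (h₀ : Fintype.card M₀ = 1)
    (hn : n ≠ 0) {R₁ R₂ : ℝ}
    (h₁ : n * (R₁ * Real.log 2) ≤
      Real.log (Fintype.card M₁) - c.errorProb p * Real.log (Fintype.card M₁) - Real.log 2)
    (h₂ : n * (R₂ * Real.log 2) ≤
      Real.log (Fintype.card M₂) - c.errorProb p * Real.log (Fintype.card M₂) - Real.log 2) :
    (R₁, R₂) ∈ hullRegion p := by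
  obtain ⟨m₀, -⟩ := Fintype.card_eq_one_iff.1 h₀
  have hn' : (0 : ℝ) < n := by positivity
  have hP := c.joint_mem p m₀
  set P := c.joint p m₀ with hPdef
  let ξ : Fin n → (M₁ × M₂) × (Fin n → Y × Z) → X := fun i ω => c.enc m₀ ω.1.1 ω.1.2 i
  let y : (M₁ × M₂) × (Fin n → Y × Z) → Fin n → Y := fun ω i => (ω.2 i).1
  let z : (M₁ × M₂) × (Fin n → Y × Z) → Fin n → Z := fun ω i => (ω.2 i).2
  obtain ⟨a, b, hab, ha, hb⟩ := exists_mem_entHull_avgLaw hP hn (fun ω => ω.1.1) ξ y z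
    p.toY_mem p.toZ_mem (c.isMarkov_auxVar_toY p m₀ Prod.fst Prod.fst Prod.snd) (c.isMarkov_auxVar_toZ p m₀ Prod.fst Prod.fst Prod.snd)
  -- Here past and future trade roles: `V_i` is `M₂`, the past of `z` and the future of `y`. No
  -- compatibility with `U_i` is needed, because `hullRegion` does not see their joint law.
  obtain ⟨a', b', hab', ha', hb'⟩ := exists_mem_entHull_avgLaw hP hn (fun ω => ω.1.2) ξ z y
    p.toZ_mem p.toY_mem (c.isMarkov_auxVar_toZ p m₀ Prod.snd Prod.snd Prod.fst) (c.isMarkov_auxVar_toY p m₀ Prod.snd Prod.snd Prod.fst)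
  have hy : ent P y ≤ n * outEnt p.toY (avgLaw P ξ) :=
    ent_block_le hP hn ξ y p.toY fun i => (c.isMarkov_auxVar_toY p m₀ id Prod.fst Prod.snd i).law_out
  have hz : ent P z ≤ n * outEnt p.toZ (avgLaw P ξ) :=
    ent_block_le hP hn ξ z p.toZ fun i => (c.isMarkov_auxVar_toZ p m₀ id Prod.fst Prod.snd i).law_out
  -- With both messages in the auxiliary, each letter still has conditional entropy at least that of
  -- the channel noise.
  have hmy : ent P Prod.fst + n * noiseEnt p.toY (avgLaw P ξ) ≤ ent P (fun ω => (ω.1, y ω)) := by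
    have := sum_ent_auxVar_le hP.1 Prod.fst y z
    have h2 := Finset.sum_le_sum fun i (_ : i ∈ Finset.univ) =>
      (c.isMarkov_auxVar_toY p m₀ id Prod.fst Prod.snd i).noiseEnt_le hP.1 p.toY_mem
    rw [sum_noiseEnt hn] at h2
    have h3 := h2.trans this
    linarith
  have hmz : ent P Prod.fst + n * noiseEnt p.toZ (avgLaw P ξ) ≤ ent P (fun ω => (ω.1, z ω)) := by
    have := sum_ent_auxVar_le hP.1 Prod.fst z y
    have h2 := Finset.sum_le_sum fun i (_ : i ∈ Finset.univ) =>
      (c.isMarkov_auxVar_toZ p m₀ id Prod.snd Prod.fst i).noiseEnt_le hP.1 p.toZ_mem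
    rw [sum_noiseEnt hn] at h2
    have h3 := h2.trans this
    linarith
  have f₁ : ent P (fun ω => (ω.1.1, y ω)) - ent P y ≤ _ := c.ent_message₁_le p m₀ h₀
  have f₂ : ent P (fun ω => (ω.1.2, z ω)) - ent P z ≤ _ := c.ent_message₂_le p m₀ h₀
  have e₀ : ent P Prod.fst = _ := c.ent_messages p m₀
  have e₁ : ent P (fun ω => ω.1.1) = _ := c.ent_message₁ p m₀
  have e₂ : ent P (fun ω => ω.1.2) = _ := c.ent_message₂ p m₀
  -- Knowing `M₁` as well only lowers `H(M₂|Z^n)`, which Fano's inequality bounds; this controls the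
  -- term `I(M₂;Z^n|M₁)` of the sum rate.
  have s₁ : ent P (fun ω => (ω.1, z ω)) - ent P (fun ω => (ω.1.1, z ω)) ≤
      ent P (fun ω => (ω.1.2, z ω)) - ent P z := by
    have := ent_submodular hP.1 (fun ω => ω.1.1) (fun ω => ω.1.2) z
    rw [ent_congr (f := fun ω => (ω.1.1, ω.1.2, z ω)) (g := fun ω => (ω.1, z ω))
      (fun _ _ _ _ => by simp only [Prod.ext_iff]; tauto)] at this
    linarith
  have s₂ : ent P (fun ω => (ω.1, y ω)) - ent P (fun ω => (ω.1.2, y ω)) ≤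
      ent P (fun ω => (ω.1.1, y ω)) - ent P y := by
    have := ent_submodular hP.1 (fun ω => ω.1.1) (fun ω => ω.1.2) y
    rw [ent_congr (f := fun ω => (ω.1.1, ω.1.2, y ω)) (g := fun ω => (ω.1, y ω))
      (fun _ _ _ _ => by simp only [Prod.ext_iff]; tauto)] at this
    linarith
  refine ⟨avgLaw P ξ, a, b, a', b', hab, hab', ?_, ?_, ?_, ?_⟩ <;>
    refine le_of_mul_le_mul_left ?_ hn' <;> dsimp only
  · linarith
  · linarith
  · linarith
  · linarith

end CodeSpace

/-! ### From achievable pairs to the capacity region -/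

section Capacity

variable {X Y Z : Type*} [Fintype X] [Fintype Y] [Fintype Z]

theorem log_card_message_ge {R : ℝ} (hR : 0 ≤ R) (n : ℕ) :
    0 < Fintype.card (Message n R) ∧
      n * (R * Real.log 2) - Real.log 2 ≤ Real.log (Fintype.card (Message n R)) := by
  rw [Fintype.card_fin]
  set x : ℝ := (2 : ℝ) ^ ((n : ℝ) * R) with hx
  have h1 : 1 ≤ x := Real.one_le_rpow one_le_two (by positivity)
  have h2 : 0 < ⌊x⌋₊ := Nat.floor_pos.2 h1
  refine ⟨h2, ?_⟩
  -- Since `x ≥ 1`, rounding down at most halves the number of messages, a loss of at most one bit.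
  have h3 : x / 2 ≤ ⌊x⌋₊ := by
    have h4 := Nat.lt_floor_add_one x
    have h5 : (1 : ℝ) ≤ ⌊x⌋₊ := by exact_mod_cast h2
    linarith
  have h6 := Real.log_le_log (by positivity) h3
  rw [Real.log_div (by positivity) two_ne_zero, hx, Real.log_rpow two_pos] at h6
  linarith

theorem mem_hullRegion_of_achievable (p : Channel X Y Z) {R₁ R₂ : ℝ}
    (h : Achievable p 0 R₁ R₂) : (R₁, R₂) ∈ hullRegion p := by
  obtain ⟨-, h1, h2, c, hc⟩ := h
  have hl : 0 < Real.log 2 := Real.log_pos one_lt_two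
  -- The rate certified at length `n`: the inner `1/n` pays for the rounding of the message set, the
  -- outer one for the constant bit in Fano's inequality.
  have key : ∀ {R : ℝ}, 0 ≤ R → Tendsto (fun n : ℕ => (1 - (c n).errorProb p) * (R - (n : ℝ)⁻¹) -
      (n : ℝ)⁻¹) atTop (𝓝 R) := fun {R} _ => by
    have hi := tendsto_inv_atTop_nhds_zero_nat (𝕜 := ℝ)
    simpa using ((hc.const_sub 1).mul (hi.const_sub R)).sub hi
  refine (isClosed_hullRegion p).mem_of_tendsto ((key h1).prodMk_nhds (key h2)) ?_
  -- Error at most one keeps the factor `1 - errorProb` nonnegative when it multiplies the bound on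
  -- the message count.
  filter_upwards [eventually_ne_atTop 0, hc.eventually_le_const one_pos] with n hn hε
  have bound : ∀ {R : ℝ}, 0 ≤ R →
      n * (((1 - (c n).errorProb p) * (R - (n : ℝ)⁻¹) - (n : ℝ)⁻¹) * Real.log 2) ≤
      Real.log (Fintype.card (Message n R)) -
        (c n).errorProb p * Real.log (Fintype.card (Message n R)) - Real.log 2 := fun {R} hR => by
    have h3 := mul_le_mul_of_nonneg_left (log_card_message_ge hR n).2 (sub_nonneg.2 hε)
    have hn' : (n : ℝ) ≠ 0 := Nat.cast_ne_zero.2 hn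
    have e : n * (((1 - (c n).errorProb p) * (R - (n : ℝ)⁻¹) - (n : ℝ)⁻¹) * Real.log 2) =
        (1 - (c n).errorProb p) * (n * (R * Real.log 2) - Real.log 2) - Real.log 2 := by
      field_simp
    rw [e]
    linarith
  have : Nonempty (Message n R₁) := Fintype.card_pos_iff.1 (log_card_message_ge h1 n).1
  have : Nonempty (Message n R₂) := Fintype.card_pos_iff.1 (log_card_message_ge h2 n).1
  exact (c n).mem_hullRegion p (by simp) hn (bound h1) (bound h2)

theorem capacityRegionNoCommon_subset_hullRegion (p : Channel X Y Z) :
    capacityRegionNoCommon p ⊆ hullRegion p :=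
  closure_minimal (fun _ h => mem_hullRegion_of_achievable p h) (isClosed_hullRegion p)

end Capacity

end

end BCOuter

/-! ### Closing the cycle of inclusions -/

theorem lemma3p5 {X Y Z : Type*} [Fintype X] [Fintype Y] [Fintype Z]
    (p : BCOuter.Channel X Y Z) :
    BCOuter.capacityRegionNoCommon p ⊆ BCOuter.outerBoundXDet p ∧
      BCOuter.outerBound p = BCOuter.outerBoundXDet p ∧
      BCOuter.outerBoundX p = BCOuter.outerBoundXDet p := by
  have h1 := BCOuter.outerBound_subset_outerBoundX p
  have h2 := BCOuter.outerBoundXDet_subset_outerBound p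
  have h3 := (BCOuter.outerBoundX_subset_hullRegion p).trans
    (BCOuter.hullRegion_subset_outerBoundXDet p)
  exact ⟨(BCOuter.capacityRegionNoCommon_subset_hullRegion p).trans
    (BCOuter.hullRegion_subset_outerBoundXDet p), (h1.trans h3).antisymm h2,
    h3.antisymm (h2.trans h1)⟩
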